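/- Let $(\mathcal M,\otimes,K,c)$ be a braided monoidal category in which idempotents split, and let $(B,\mu,\eta)$ be a monoid in $\mathcal M$ (coherence isomorphisms are suppressed; composites are written right to left). A *weak bimonoid* structure on $(B,\mu,\eta)$ is a comonoid structure $(\delta:B\to B\otimes B,\ \varepsilon:B\to K)$ such that $$\delta\mu=(\mu\otimes\mu)(B\otimes c_{B,B}\otimes B)(\delta\otimes\delta),$$ $$\varepsilon\mu(\mu\otimes B)=(\varepsilon\otimes\varepsilon)(\mu\otimes\mu)(B\otimes\delta\otimes B)=(\varepsilon\otimes\varepsilon)(\mu\otimes\mu)(B\otimes c_{B,B}^{-1}\otimes B)(B\otimes\delta\otimes B),$$ $$(\delta\otimes B)\delta\eta=(B\otimes\mu\otimes B)(\delta\otimes\delta)(\eta\otimes\eta)=(B\otimes\mu\otimes B)(B\otimes c_{B,B}^{-1}\otimes B)(\delta\otimes\delta)(\eta\otimes\eta).$$ A *weak bimonad* structure on a monad $T=(T,m,u)$ on $\mathcal M$ is a monoidal structure $(\boxtimes,(R,r))$ on the category $\mathcal M^T$ of $T$-algebras together with a separable Frobenius structure on the forgetful functor $U:\mathcal M^T\to\mathcal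 M$, i.e. a monoidal structure $(p_{A,A'}:UA\otimes UA'\to U(A\boxtimes A'),\ p_0:K\to R)$ and an opmonoidal structure $(i_{A,A'}:U(A\boxtimes A')\to UA\otimes UA',\ i_0:R\to K)$ on $U$ with $p_{A,A'}i_{A,A'}=1$, $\ i_{A\boxtimes A',A''}\,p_{A,A'\boxtimes A''}=(p_{A,A'}\otimes UA'')(UA\otimes i_{A',A''})$ and $i_{A,A'\boxtimes A''}\,p_{A\boxtimes A',A''}=(UA\otimes p_{A',A''})(i_{A,A'}\otimes UA'')$. Its underlying opmonoidal structure $(\tau,\tau_0)$ on $T$ is $\tau_0=i_0\circ r\circ Tp_0$ and $$\tau_{X,Y}=i_{TX,TY}\circ a_{X,Y}\circ Tp_{TX,TY}\circ T(u_X\otimes u_Y):T(X\otimes Y)\to TX\otimes TY,$$ where $TX,TY$ carry the free algebra structures and $a_{X,Y}$ is the $T$-action on $TX\boxtimes TY$. **Theorem.** Consider the monad $\bullet\otimes B=(\bullet\otimes B,\bullet\otimes\mu,\bullet\otimes\eta)$ on $\mathcal M$. (a) The assignment $(\delta,\varepsilon)=(\tau_{K,K},\tau_0)$ defines a bijection between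 1. weak bimonoid structures $(\delta,\varepsilon)$ on $(B,\mu,\eta)$, and 2. opmonoidal structures $(\tau,\tau_0)$ on $\bullet\otimes B$ that underlie a weak bimonad structure on the monad $\bullet\otimes B$ and satisfy, for all objects $X,Y$ of $\mathcal M$, $$\tau_{X,Y}=(X\otimes c_{Y,B}\otimes B)\circ(X\otimes Y\otimes\tau_{K,K}).$$ The inverse bijection sends $(\delta,\varepsilon)$ to $\tau_{X,Y}=(X\otimes c_{Y,B}\otimes B)(X\otimes Y\otimes\delta)$, $\tau_0=\varepsilon$. (b) Two weak bimonad structures on the monad $\bullet\otimes B$ have the same underlying $(\tau,\tau_0)$ if and only if they are isomorphic, that is, the identity functor of $\mathcal M^{\bullet\otimes B}$ admits a strong monoidal structure between the two monoidal structures that is compatible with both the monoidal and the opmonoidal structures of the two forgetful functors. Hence (2) is the set of isomorphism classes of weak bimonad structures on $\bullet\otimes B$ that satisfy the displayed condition. -/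

import Mathlib

open CategoryTheory CategoryTheory.MonoidalCategory

universe v₁ v₂ u₁ u₂

/-- A separable Frobenius structure on a functor `F` between monoidal categories: a monoidal
structure `(μ, ε)` (the `p` and `p₀` of the literature) and an opmonoidal structure `(δ, η)`
(`i` and `i₀`), satisfying the two Frobenius compatibilities, and with `μ` a retraction of `δ`. -/
structure SeparableFrobenius {C : Type u₁} [Category.{v₁} C] [MonoidalCategory C]
    {D : Type u₂} [Category.{v₂} D] [MonoidalCategory D] (F : C ⥤ D)
    extends F.LaxMonoidal, F.OplaxMonoidal where
  frobenius_left : ∀ X Y Z : C,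
    μ X (Y ⊗ Z) ≫ F.map (α_ X Y Z).inv ≫ δ (X ⊗ Y) Z =
      F.obj X ◁ δ Y Z ≫ (α_ (F.obj X) (F.obj Y) (F.obj Z)).inv ≫ μ X Y ▷ F.obj Z
  frobenius_right : ∀ X Y Z : C,
    μ (X ⊗ Y) Z ≫ F.map (α_ X Y Z).hom ≫ δ X (Y ⊗ Z) =
      δ X Y ▷ F.obj Z ≫ (α_ (F.obj X) (F.obj Y) (F.obj Z)).hom ≫ F.obj X ◁ μ Y Z
  separable : ∀ X Y : C, δ X Y ≫ μ X Y = 𝟙 (F.obj (X ⊗ Y))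

/-- A weak bimonad structure on a monad `T` on a monoidal category: a monoidal structure on the
Eilenberg-Moore category of `T` and a separable Frobenius structure on the forgetful functor. -/
structure WeakBimonad {C : Type u₁} [Category.{v₁} C] [MonoidalCategory C] (T : Monad C) where
  /-- the monoidal structure on the category of algebras -/
  monoidal : MonoidalCategory T.Algebra
  /-- the separable Frobenius structure on the forgetful functor -/
  frobenius : SeparableFrobenius T.forget

namespace WeakBimonad

variable {C : Type u₁} [Category.{v₁} C] [MonoidalCategory C] {T : Monad C}

/-- The morphism `τ₀`: the composite `T K ⟶ T R ⟶ R ⟶ K`, where `R` is the unit of the category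
of algebras. -/
def tau₀ (W : WeakBimonad T) : T.obj (𝟙_ C) ⟶ 𝟙_ C :=
  letI := W.monoidal
  T.map W.frobenius.ε ≫ (𝟙_ T.Algebra).a ≫ W.frobenius.η

/-- The morphism `τ X Y`: the composite
`T (X ⊗ Y) ⟶ T (TX ⊗ TY) ⟶ T (TX □ TY) ⟶ TX □ TY ⟶ TX ⊗ TY`, where `□` is the tensor product of
(free) algebras. -/
def tau (W : WeakBimonad T) (X Y : C) : T.obj (X ⊗ Y) ⟶ T.obj X ⊗ T.obj Y :=
  letI := W.monoidal
  T.map (T.η.app X ⊗ₘ T.η.app Y) ≫ T.map (W.frobenius.μ (T.free.obj X) (T.free.obj Y)) ≫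
    (T.free.obj X ⊗ T.free.obj Y).a ≫ W.frobenius.δ (T.free.obj X) (T.free.obj Y)

/-- The opmonoidal structure `(τ, τ₀)` on `T` that underlies a weak bimonad. -/
@[reducible]
def opmonoidal (W : WeakBimonad T) : T.toFunctor.OplaxMonoidal :=
  letI := W.monoidal
  letI := W.frobenius.toLaxMonoidal
  letI := W.frobenius.toOplaxMonoidal
  letI := T.adj.leftAdjointOplaxMonoidal
  letI c : (T.free ⋙ T.forget).OplaxMonoidal := inferInstance
  have hη : c.η = W.tau₀ := by
    simp [c, tau₀, Adjunction.leftAdjointOplaxMonoidal_η, Adjunction.homEquiv_counit]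
    exact Category.assoc (T.map W.frobenius.ε) (𝟙_ T.Algebra).a W.frobenius.η
  have hδ : c.δ = W.tau := by
    funext X Y
    simp [c, tau, Adjunction.leftAdjointOplaxMonoidal_δ, Adjunction.homEquiv_counit]
    exact (Category.assoc (T.map _ ≫ T.map _) _ _).trans (Category.assoc (T.map _) (T.map _) _)
  { η := W.tau₀
    δ := W.tau
    δ_natural_left := hδ ▸ c.δ_natural_left
    δ_natural_right := hδ ▸ c.δ_natural_right
    oplax_associativity := hδ ▸ c.oplax_associativity
    oplax_left_unitality := hδ ▸ hη ▸ c.oplax_left_unitality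
    oplax_right_unitality := hδ ▸ hη ▸ c.oplax_right_unitality }

/-- An isomorphism between two weak bimonad structures on the same monad: a strong monoidal
structure on the identity functor of the category of algebras, from the first monoidal structure
to the second, that is compatible with the monoidal and the opmonoidal structures of the two
forgetful functors. -/
structure Iso (W W' : WeakBimonad T) where
  /-- the strong monoidal structure on the identity functor -/
  monoidal : @Functor.Monoidal T.Algebra _ W.monoidal T.Algebra _ W'.monoidal (𝟭 T.Algebra)
  ε_comp : W'.frobenius.ε ≫ T.forget.map monoidal.ε = W.frobenius.ε
  μ_comp : ∀ A B : T.Algebra,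
    W'.frobenius.μ A B ≫ T.forget.map (monoidal.μ A B) = W.frobenius.μ A B
  η_comp : T.forget.map monoidal.η ≫ W'.frobenius.η = W.frobenius.η
  δ_comp : ∀ A B : T.Algebra,
    T.forget.map (monoidal.δ A B) ≫ W'.frobenius.δ A B = W.frobenius.δ A B

end WeakBimonad

section Monoid

variable {C : Type u₁} [Category.{v₁} C] [MonoidalCategory C]

/-- The monad `• ⊗ B` associated to a monoid `B`, with multiplication `• ⊗ μ` and unit `• ⊗ η`. -/
def tensorMonad (B : C) [MonObj B] : Monad C where
  toFunctor := tensorRight B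
  η :=
    { app := fun X ↦ (ρ_ X).inv ≫ X ◁ MonObj.one (X := B)
      naturality := fun X Y f ↦ by
        simp [whisker_exchange] }
  μ :=
    { app := fun X ↦ (α_ X B B).hom ≫ X ◁ MonObj.mul (X := B)
      naturality := fun X Y f ↦ by
        simp [whisker_exchange] }
  assoc X := by
    have h := congrArg (fun f ↦ X ◁ f) (MonObj.mul_assoc B)
    simp only [MonoidalCategory.whiskerLeft_comp] at h
    simp [h]
  left_unit X := by
    simp [← MonoidalCategory.whiskerLeft_comp]
  right_unit X := by
    simp [← MonoidalCategory.whiskerLeft_comp]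

open scoped MonObj in
/-- A weak bimonoid structure on a monoid `B` in a braided monoidal category: a comonoid structure
`(Δ, ε)` on `B` subject to the compatibility conditions below. Here `⊗≫` is composition up to
coherence isomorphisms, `tensorμ B B B B` is `B ⊗ c ⊗ B`, and `tensorδ B B B B` is
`B ⊗ c⁻¹ ⊗ B`, where `c` is the braiding of `B` with itself. -/
structure WeakBimonoid [BraidedCategory C] (B : C) [MonObj B] extends ComonObj B where
  mul_comul : μ[B] ≫ comul = (comul ⊗ₘ comul) ≫ tensorμ B B B B ≫ (μ[B] ⊗ₘ μ[B])
  counit_mul_mul : μ[B] ▷ B ≫ μ[B] ≫ counit =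
    (B ◁ comul) ▷ B ⊗≫ (μ[B] ⊗ₘ μ[B]) ≫ (counit ⊗ₘ counit) ≫ (λ_ (𝟙_ C)).hom
  counit_mul_mul_braid : μ[B] ▷ B ≫ μ[B] ≫ counit =
    (B ◁ comul) ▷ B ⊗≫ tensorδ B B B B ≫ (μ[B] ⊗ₘ μ[B]) ≫ (counit ⊗ₘ counit) ≫
      (λ_ (𝟙_ C)).hom
  comul_comul_one : η[B] ≫ comul ≫ comul ▷ B =
    (λ_ (𝟙_ C)).inv ≫ (η[B] ⊗ₘ η[B]) ≫ (comul ⊗ₘ comul) ⊗≫ (B ◁ μ[B]) ▷ B ⊗≫ 𝟙 ((B ⊗ B) ⊗ B)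
  comul_comul_one_braid : η[B] ≫ comul ≫ comul ▷ B =
    (λ_ (𝟙_ C)).inv ≫ (η[B] ⊗ₘ η[B]) ≫ (comul ⊗ₘ comul) ≫ tensorδ B B B B ⊗≫
      (B ◁ μ[B]) ▷ B ⊗≫ 𝟙 ((B ⊗ B) ⊗ B)

/-- The morphism `τ_{K,K}` of an opmonoidal structure on `• ⊗ B`, regarded as a morphism
`B ⟶ B ⊗ B` through the unit constraints. -/
def comulOf (B : C) [MonObj B] (τ : (tensorMonad B).toFunctor.OplaxMonoidal) : B ⟶ B ⊗ B :=
  (λ_ B).inv ≫ (λ_ (𝟙_ C)).inv ▷ B ≫ τ.δ (𝟙_ C) (𝟙_ C) ≫ ((λ_ B).hom ⊗ₘ (λ_ B).hom)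

/-- The morphism `τ₀` of an opmonoidal structure on `• ⊗ B`, regarded as a morphism `B ⟶ K`
through the unit constraint. -/
def counitOf (B : C) [MonObj B] (τ : (tensorMonad B).toFunctor.OplaxMonoidal) : B ⟶ 𝟙_ C :=
  (λ_ B).inv ≫ τ.η

/-- The condition that `τ_{X,Y}` is the composite of `X ⊗ Y ⊗ τ_{K,K}` and
`X ⊗ c_{Y,B} ⊗ B = tensorμ X Y B B`. -/
def FactorsThroughBraiding [BraidedCategory C] (B : C) [MonObj B]
    (τ : (tensorMonad B).toFunctor.OplaxMonoidal) : Prop :=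
  ∀ X Y : C, τ.δ X Y = (X ⊗ Y) ◁ comulOf B τ ≫ tensorμ X Y B B

/-- The weak bimonads `(• ⊗ B, • ⊗ μ, • ⊗ η, τ, τ₀)` for which `τ` factors through `τ_{K,K}` and
the braiding: opmonoidal structures on `• ⊗ B` that underlie a weak bimonad. -/
def BraidedWeakBimonad [BraidedCategory C] (B : C) [MonObj B] : Type (max u₁ v₁) :=
  { τ : (tensorMonad B).toFunctor.OplaxMonoidal //
    (∃ W : WeakBimonad (tensorMonad B), W.opmonoidal = τ) ∧ FactorsThroughBraiding B τ }

end Monoid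

/-! The heart of the proof is an intrinsic description, `IsWeaklyBimonoidal`, of the opmonoidal
structures that underlie a weak bimonad. For algebras `A`, `B` the map `act A B` is an associative,
possibly non-unital action on `A ⊗ B`, so that acting by the unit gives an idempotent `idem A B`.
The tensor product of algebras has to be its splitting. The unit algebra has to split `unitIdem` on
`T K`, which for `• ⊗ B` is the projection `b ↦ ε(b 1₁) 1₂` onto the base algebra.

If the conditions hold, splitting these idempotents gives the monoidal structure. Associators
descend from the base category, and the two Frobenius laws are the two conditions on products of
idempotents. The unitors are the delicate point: the conditions on `form` make the contractions
morphisms of algebras and let them slide between tensor factors (`map_contractL_mul`,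
`idem_unitIdem_left`), which makes the unitors invertible.

Conversely, in any weak bimonad naturality of `p` and `i` along the actions forces `act A B = T p ≫
a ≫ i` (`WeakBimonad.act_eq`), and `unitIdem` factors through the unit algebra. This yields the
conditions. It also shows that every weak bimonad with a given `(τ, τ₀)` splits the same
idempotents, compatibly with the actions; splittings are unique up to a unique compatible
isomorphism, which is part (b).

For `T = • ⊗ B`, opmonoidal structures that factor through the braiding are the same as comonoid
structures on `B`: evaluate at the unit object. Under this correspondence the five conditions become
the five weak bimonoid axioms. The conditions on `form` become the counit axioms, with `c⁻¹`
produced by sliding a strand past a contraction. The conditions on idempotents compare actions of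
points of `(B ⊗ B) ⊗ B`; they reduce to the unit axioms because a monoid acts faithfully on itself.
-/

namespace CategoryTheory.Monad

open Functor.OplaxMonoidal

/-! ### Algebras presented as splittings of non-unital actions. -/

variable {C : Type u₁} [Category.{v₁} C] {T : Monad C}

/-- The unit of a monad, with the identity functor unfolded in its type. -/
def unit (T : Monad C) (X : C) : X ⟶ T.obj X := T.η.app X

/-- The multiplication of a monad, with the composite functor unfolded in its type. -/
def mul (T : Monad C) (X : C) : T.obj (T.obj X) ⟶ T.obj X := T.μ.app X

lemma comp_unit {X Y : C} (f : X ⟶ Y) : f ≫ T.unit Y = T.unit X ≫ T.map f := T.η.naturality f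

lemma map_map_mul {X Y : C} (f : X ⟶ Y) : T.map (T.map f) ≫ T.mul Y = T.mul X ≫ T.map f :=
  T.μ.naturality f

@[simp]
lemma unit_mul (X : C) : T.unit (T.obj X) ≫ T.mul X = 𝟙 _ := T.left_unit X

@[simp]
lemma unit_mul_assoc {X Y : C} (f : T.obj X ⟶ Y) : T.unit (T.obj X) ≫ T.mul X ≫ f = f := by
  rw [← Category.assoc, unit_mul, Category.id_comp]

@[simp]
lemma map_unit_mul (X : C) : T.map (T.unit X) ≫ T.mul X = 𝟙 _ := T.right_unit X

@[simp]
lemma map_unit_mul_assoc {X Y : C} (f : T.obj X ⟶ Y) : T.map (T.unit X) ≫ T.mul X ≫ f = f := by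
  rw [← Category.assoc, map_unit_mul, Category.id_comp]

lemma map_mul_mul (X : C) : T.map (T.mul X) ≫ T.mul X = T.mul (T.obj X) ≫ T.mul X := T.assoc X

@[simp]
lemma unit_a (A : T.Algebra) : T.unit A.A ≫ A.a = 𝟙 A.A := A.unit

@[simp]
lemma unit_a_assoc (A : T.Algebra) {Y : C} (f : A.A ⟶ Y) : T.unit A.A ≫ A.a ≫ f = f := by
  rw [← Category.assoc, unit_a, Category.id_comp]

lemma map_a_a (A : T.Algebra) : T.map A.a ≫ A.a = T.mul A.A ≫ A.a := A.assoc.symm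

lemma map_f_a {A B : T.Algebra} (f : A ⟶ B) : T.map f.f ≫ B.a = A.a ≫ f.f := f.h

/-- A morphism `x : T X ⟶ X` presents an algebra `A` as a retract of `X`, when the
idempotent `u ≫ x` splits through `A` and the retraction is compatible with the actions. -/
structure Presentation {X : C} (x : T.obj X ⟶ X) (A : T.Algebra) where
  /-- the retraction -/
  p : X ⟶ A.A
  /-- the section -/
  i : A.A ⟶ X
  i_p : i ≫ p = 𝟙 A.A
  p_i : p ≫ i = T.unit X ≫ x
  map_p_a : T.map p ≫ A.a = x ≫ p

namespace Presentation

attribute [simp] i_p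

variable {X : C} {x : T.obj X ⟶ X} {A : T.Algebra} (r : Presentation x A)
  {X' : C} {x' : T.obj X' ⟶ X'} {A' : T.Algebra} (r' : Presentation x' A')

@[simp]
lemma i_p_assoc {Y : C} (f : A.A ⟶ Y) : r.i ≫ r.p ≫ f = f := by
  rw [← Category.assoc, i_p, Category.id_comp]

instance : IsSplitEpi r.p := ⟨⟨⟨r.i, r.i_p⟩⟩⟩

lemma p_comp_idem : r.p = T.unit X ≫ x ≫ r.p := by
  rw [← reassoc_of% r.p_i, r.i_p, Category.comp_id]

lemma map_p_comp {f : A.A ⟶ A'.A} (h : x ≫ r.p ≫ f = T.map (r.p ≫ f) ≫ A'.a) :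
    T.map f ≫ A'.a = A.a ≫ f := by
  rw [← cancel_epi (T.map r.p), reassoc_of% r.map_p_a, h, T.map_comp_assoc]

/-- A morphism of the presenting objects which is compatible with the actions induces a
morphism of the presented algebras. -/
@[simps]
def hom (f : X ⟶ X') (hf : x ≫ f = T.map f ≫ x') : A ⟶ A' where
  f := r.i ≫ f ≫ r'.p
  h := r.map_p_comp <| by
    have : r.p ≫ r.i ≫ f ≫ r'.p = f ≫ r'.p := by
      rw [reassoc_of% r.p_i, reassoc_of% hf, ← reassoc_of% T.comp_unit, ← p_comp_idem]
    rw [this, reassoc_of% hf, T.map_comp_assoc, r'.map_p_a]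

lemma p_hom (f : X ⟶ X') (hf : x ≫ f = T.map f ≫ x') :
    r.p ≫ (r.hom r' f hf).f = f ≫ r'.p := by
  rw [hom_f, reassoc_of% r.p_i, reassoc_of% hf, ← reassoc_of% T.comp_unit, ← p_comp_idem]

/-- Commuting with the actions implies commuting with the idempotents, by naturality of the unit;
hence the induced morphism is compatible with the sections and not only with the retractions. -/
lemma hom_i (f : X ⟶ X') (hf : x ≫ f = T.map f ≫ x') :
    (r.hom r' f hf).f ≫ r'.i = r.i ≫ f := by
  rw [hom_f, Category.assoc, Category.assoc, r'.p_i, reassoc_of% T.comp_unit, ← hf,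
    ← reassoc_of% r.p_i, r.i_p_assoc]

lemma hom_ext {f g : A ⟶ A'} (h : r.p ≫ f.f = r.p ≫ g.f) : f = g := by
  ext
  rwa [← cancel_epi r.p]

/-- An isomorphism of the presenting objects which is compatible with the actions induces an
isomorphism of the presented algebras. -/
def iso (f : X ≅ X') (hf : x ≫ f.hom = T.map f.hom ≫ x') : A ≅ A' :=
  have hf' : x' ≫ f.inv = T.map f.inv ≫ x := by
    rw [← cancel_epi (T.map f.hom), ← reassoc_of% hf]
    simp [← T.map_comp_assoc]
  { hom := r.hom r' f.hom hf
    inv := r'.hom r f.inv hf'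
    hom_inv_id := r.hom_ext <| by
      rw [Algebra.comp_f, reassoc_of% p_hom, p_hom, f.hom_inv_id_assoc]
      exact (Category.comp_id _).symm
    inv_hom_id := r'.hom_ext <| by
      rw [Algebra.comp_f, reassoc_of% p_hom, p_hom, f.inv_hom_id_assoc]
      exact (Category.comp_id _).symm }

end Presentation

/-- Associativity and naturality of the unit give `x ≫ u ≫ x = x`, so `u ≫ x` is idempotent. On its
splitting the unit law holds by construction, and associativity survives because `T (u ≫ x) ≫ x =
x`. -/
lemma exists_presentation [IsIdempotentComplete C] {X : C} (x : T.obj X ⟶ X)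
    (hx : T.map x ≫ x = T.mul X ≫ x) : ∃ A : T.Algebra, Nonempty (Presentation x A) := by
  have hxx : x ≫ T.unit X ≫ x = x := by
    rw [reassoc_of% T.comp_unit, hx, T.unit_mul_assoc]
  have hmap : T.map (T.unit X ≫ x) ≫ x = x := by
    rw [T.map_comp_assoc, hx, T.map_unit_mul_assoc]
  obtain ⟨Y, i, p, hip, hpi⟩ := IsIdempotentComplete.idempotents_split X (T.unit X ≫ x)
    (by rw [Category.assoc, hxx])
  refine ⟨{ A := Y, a := T.map i ≫ x ≫ p, unit := ?_, assoc := ?_ }, ⟨⟨p, i, hip, hpi, ?_⟩⟩⟩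
  · change T.unit Y ≫ _ = _
    rw [← reassoc_of% T.comp_unit, ← Category.assoc _ x p, ← hpi, Category.assoc, hip,
      Category.comp_id, hip]
  · change T.mul Y ≫ _ = _
    simp only [T.map_comp, Category.assoc]
    rw [← reassoc_of% T.map_map_mul, ← reassoc_of% hx]
    congr 2
    rw [← T.map_comp_assoc p i, hpi, reassoc_of% hmap]
  · dsimp
    rw [← T.map_comp_assoc, hpi, reassoc_of% hmap]

end CategoryTheory.Monad

/-! ### Actions on tensor products, and contractions against the counit. -/

namespace CategoryTheory.Monad

open Functor.OplaxMonoidal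

variable {C : Type u₁} [Category.{v₁} C] [MonoidalCategory C] {T : Monad C}

/-- The free algebra on an object, with action `T.mul X`. -/
abbrev freeAlgebra (T : Monad C) (X : C) : T.Algebra where
  A := T.obj X
  a := T.mul X
  unit := T.left_unit X
  assoc := (T.assoc X).symm

/-- The algebra morphism `freeAlgebra A.A ⟶ A` given by the action of `A`. -/
abbrev actionHom (A : T.Algebra) : T.freeAlgebra A.A ⟶ A where
  f := A.a
  h := A.assoc.symm

section

variable [T.toFunctor.OplaxMonoidal]

/-- The (possibly non-unital) action on the tensor product of the underlying objects of two
algebras. -/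
def act (A B : T.Algebra) : T.obj (A.A ⊗ B.A) ⟶ A.A ⊗ B.A :=
  δ T.toFunctor A.A B.A ≫ (A.a ⊗ₘ B.a)

/-- The endomorphism of `A ⊗ B` given by the action of the unit; its splitting is the tensor
product of algebras. -/
def idem (A B : T.Algebra) : A.A ⊗ B.A ⟶ A.A ⊗ B.A := T.unit _ ≫ act A B

/-- The action on a triple tensor product, bracketed to the left. -/
def actL (A B D : T.Algebra) : T.obj ((A.A ⊗ B.A) ⊗ D.A) ⟶ (A.A ⊗ B.A) ⊗ D.A :=
  δ T.toFunctor (A.A ⊗ B.A) D.A ≫ (act A B ⊗ₘ D.a)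

/-- The action on a triple tensor product, bracketed to the right. -/
def actR (A B D : T.Algebra) : T.obj (A.A ⊗ B.A ⊗ D.A) ⟶ A.A ⊗ B.A ⊗ D.A :=
  δ T.toFunctor A.A (B.A ⊗ D.A) ≫ (A.a ⊗ₘ act B D)

variable (T) in
/-- The counit of `T`, after multiplication. -/
def form : T.obj (T.obj (𝟙_ C)) ⟶ 𝟙_ C := T.mul (𝟙_ C) ≫ Functor.OplaxMonoidal.η T.toFunctor

variable (T) in
/-- Contraction of the left leg of `δ` against an element of `T (𝟙_ C)`. -/
def contractL (Y : C) : T.obj (T.obj (𝟙_ C) ⊗ Y) ⟶ T.obj Y :=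
  δ T.toFunctor (T.obj (𝟙_ C)) Y ≫ T.form ▷ T.obj Y ≫ (λ_ _).hom

variable (T) in
/-- Contraction of the right leg of `δ` against an element of `T (𝟙_ C)`. -/
def contractR (X : C) : T.obj (X ⊗ T.obj (𝟙_ C)) ⟶ T.obj X :=
  δ T.toFunctor X (T.obj (𝟙_ C)) ≫ T.obj X ◁ T.form ≫ (ρ_ _).hom

variable (T) in
/-- `contractL` at the monoidal unit. -/
def contractL₀ : T.obj (T.obj (𝟙_ C)) ⟶ T.obj (𝟙_ C) :=
  T.map (ρ_ _).inv ≫ T.contractL (𝟙_ C)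

variable (T) in
/-- `contractR` at the monoidal unit. -/
def contractR₀ : T.obj (T.obj (𝟙_ C)) ⟶ T.obj (𝟙_ C) :=
  T.map (λ_ _).inv ≫ T.contractR (𝟙_ C)

variable (T) in
/-- The compatibilities between a monad and an opmonoidal structure on its functor which
characterize the opmonoidal structures that underlie weak bimonads. -/
structure IsWeaklyBimonoidal : Prop where
  mul_δ (X Y : C) : T.mul (X ⊗ Y) ≫ δ T.toFunctor X Y =
    T.map (δ T.toFunctor X Y) ≫ δ T.toFunctor _ _ ≫ (T.mul X ⊗ₘ T.mul Y)
  form_contractL : T.map T.contractL₀ ≫ T.form = T.mul _ ≫ T.form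
  form_contractR : T.map T.contractR₀ ≫ T.form = T.mul _ ≫ T.form
  idem_left_right (A B D : T.Algebra) :
    idem A B ▷ D.A ≫ (α_ _ _ _).hom ≫ A.A ◁ idem B D = T.unit _ ≫ actL A B D ≫ (α_ _ _ _).hom
  idem_right_left (A B D : T.Algebra) :
    A.A ◁ idem B D ≫ (α_ _ _ _).inv ≫ idem A B ▷ D.A = T.unit _ ≫ actR A B D ≫ (α_ _ _ _).inv

lemma act_naturality {A A' B B' : T.Algebra} (f : A ⟶ A') (g : B ⟶ B') :
    act A B ≫ (f.f ⊗ₘ g.f) = T.map (f.f ⊗ₘ g.f) ≫ act A' B' := by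
  rw [act, act, ← δ_natural_assoc, Category.assoc, tensorHom_comp_tensorHom,
    tensorHom_comp_tensorHom, T.map_f_a, T.map_f_a]

lemma idem_naturality {A A' B B' : T.Algebra} (f : A ⟶ A') (g : B ⟶ B') :
    idem A B ≫ (f.f ⊗ₘ g.f) = (f.f ⊗ₘ g.f) ≫ idem A' B' := by
  rw [idem, idem, Category.assoc, act_naturality, reassoc_of% T.comp_unit]

lemma actL_associator (A B D : T.Algebra) :
    actL A B D ≫ (α_ _ _ _).hom = T.map (α_ _ _ _).hom ≫ actR A B D := by
  have h := Functor.OplaxMonoidal.associativity T.toFunctor A.A B.A D.A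
  have h₁ : act A B ⊗ₘ D.a = δ T.toFunctor A.A B.A ▷ T.obj D.A ≫ ((A.a ⊗ₘ B.a) ⊗ₘ D.a) := by
    simp only [act, ← tensorHom_id, tensorHom_comp_tensorHom, Category.id_comp]
  have h₂ : A.a ⊗ₘ act B D = T.obj A.A ◁ δ T.toFunctor B.A D.A ≫ (A.a ⊗ₘ B.a ⊗ₘ D.a) := by
    simp only [act, ← id_tensorHom, tensorHom_comp_tensorHom, Category.id_comp]
  rw [actL, actR, h₁, h₂, ← reassoc_of% h]
  simp

lemma contractL_naturality {X Y : C} (f : X ⟶ Y) :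
    T.contractL X ≫ T.map f = T.map (_ ◁ f) ≫ T.contractL Y := by
  simp [contractL, ← δ_natural_right_assoc, whisker_exchange_assoc]

lemma contractR_naturality {X Y : C} (f : X ⟶ Y) :
    T.contractR X ≫ T.map f = T.map (f ▷ _) ≫ T.contractR Y := by
  simp [contractR, ← δ_natural_left_assoc, ← whisker_exchange_assoc]

/-- The contracted variable enters only through `form`. This promotes the two conditions on `form`
to identities between contractions. -/
lemma contractL_congr {X : C} (f g : X ⟶ T.obj (𝟙_ C))
    (h : T.map f ≫ T.form = T.map g ≫ T.form) (Y : C) :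
    T.map (f ▷ Y) ≫ T.contractL Y = T.map (g ▷ Y) ≫ T.contractL Y := by
  simp only [contractL, ← δ_natural_left_assoc, ← comp_whiskerRight_assoc, h]

lemma contractR_congr {X : C} (f g : X ⟶ T.obj (𝟙_ C))
    (h : T.map f ≫ T.form = T.map g ≫ T.form) (Y : C) :
    T.map (Y ◁ f) ≫ T.contractR Y = T.map (Y ◁ g) ≫ T.contractR Y := by
  simp only [contractR, ← δ_natural_right_assoc, ← whiskerLeft_comp_assoc, h]

/-- Coassociativity: a contraction of the left leg leaves the other leg free to be comultiplied
before or after. -/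
lemma contractL_δ (Y : C) :
    T.contractL Y ≫ T.map (λ_ Y).inv ≫ δ T.toFunctor (𝟙_ C) Y =
      δ T.toFunctor (T.obj (𝟙_ C)) Y ≫ T.contractL₀ ▷ T.obj Y := by
  have h := associativity_inv T.toFunctor (T.obj (𝟙_ C)) (𝟙_ C) Y
  have h' : (ρ_ (T.obj (𝟙_ C))).inv ▷ Y = T.obj (𝟙_ C) ◁ (λ_ Y).inv ≫ (α_ _ _ _).inv := by
    simp [-left_unitality, -right_unitality]
  simp only [contractL, contractL₀, comp_whiskerRight, Category.assoc,
    Functor.OplaxMonoidal.δ_natural_left_assoc]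
  rw [h', T.map_comp_assoc, ← reassoc_of% h, ← δ_natural_right_assoc,
    ← leftUnitor_naturality (T.map (λ_ Y).inv ≫ δ T.toFunctor (𝟙_ C) Y), ← whisker_exchange_assoc,
    whiskerLeft_comp_assoc]
  simp [-left_unitality, -right_unitality, -associativity_inv, -associativity_inv_assoc]

lemma contractR_δ (X : C) :
    T.contractR X ≫ T.map (ρ_ X).inv ≫ δ T.toFunctor X (𝟙_ C) =
      δ T.toFunctor X (T.obj (𝟙_ C)) ≫ T.obj X ◁ T.contractR₀ := by
  have h := Functor.OplaxMonoidal.associativity T.toFunctor X (𝟙_ C) (T.obj (𝟙_ C))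
  have h' : X ◁ (λ_ (T.obj (𝟙_ C))).inv = (ρ_ X).inv ▷ T.obj (𝟙_ C) ≫ (α_ _ _ _).hom := by
    simp [-left_unitality, -right_unitality]
  simp only [contractR, contractR₀, whiskerLeft_comp, Category.assoc,
    Functor.OplaxMonoidal.δ_natural_right_assoc]
  rw [h', T.map_comp_assoc, ← reassoc_of% h, ← δ_natural_left_assoc,
    ← rightUnitor_naturality (T.map (ρ_ X).inv ≫ δ T.toFunctor X (𝟙_ C)), whisker_exchange_assoc,
    comp_whiskerRight_assoc]
  simp [-left_unitality, -right_unitality,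
    -Functor.OplaxMonoidal.associativity, -Functor.OplaxMonoidal.associativity_assoc]

/-- Coassociativity again: the contracted leg lies in the middle of a threefold comultiplication, so
it may be taken from either neighbour. This passes a contraction from one tensor factor to the
other. -/
lemma δ_contractR₀ (Y : C) :
    δ T.toFunctor (T.obj (𝟙_ C)) Y ≫ T.contractR₀ ▷ T.obj Y =
      T.map (λ_ _).inv ≫ δ T.toFunctor (𝟙_ C) (T.obj (𝟙_ C) ⊗ Y) ≫ _ ◁ T.contractL Y := by
  have h := associativity_inv T.toFunctor (𝟙_ C) (T.obj (𝟙_ C)) Y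
  have h' : (λ_ (T.obj (𝟙_ C))).inv ▷ Y = (λ_ _).inv ≫ (α_ _ _ _).inv := by
    simp [-left_unitality, -right_unitality]
  simp only [contractL, contractR₀, contractR, comp_whiskerRight, whiskerLeft_comp,
    Functor.OplaxMonoidal.δ_natural_left_assoc]
  rw [h', T.map_comp_assoc, ← reassoc_of% h]
  simp [-left_unitality, -right_unitality]

lemma δ_contractL₀ (X : C) :
    δ T.toFunctor X (T.obj (𝟙_ C)) ≫ T.obj X ◁ T.contractL₀ =
      T.map (ρ_ _).inv ≫ δ T.toFunctor (X ⊗ T.obj (𝟙_ C)) (𝟙_ C) ≫ T.contractR X ▷ _ := by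
  have h := Functor.OplaxMonoidal.associativity T.toFunctor X (T.obj (𝟙_ C)) (𝟙_ C)
  have h' : X ◁ (ρ_ (T.obj (𝟙_ C))).inv = (ρ_ _).inv ≫ (α_ _ _ _).hom := by
    simp [-left_unitality, -right_unitality]
  simp only [contractR, contractL₀, contractL, comp_whiskerRight, whiskerLeft_comp,
    Functor.OplaxMonoidal.δ_natural_right_assoc]
  rw [h', T.map_comp_assoc, ← reassoc_of% h]
  simp [-left_unitality, -right_unitality]

end

end CategoryTheory.Monad

/-! ### The unit idempotent, and what the compatibility conditions imply for contractions. -/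

namespace CategoryTheory.Monad

open Functor.OplaxMonoidal

variable {C : Type u₁} [Category.{v₁} C] [MonoidalCategory C] {T : Monad C}
  [T.toFunctor.OplaxMonoidal]

lemma δ_form_left (X : C) :
    δ T.toFunctor (𝟙_ C) X ≫ Functor.OplaxMonoidal.η T.toFunctor ▷ T.obj X =
      T.map (λ_ X).hom ≫ (λ_ _).inv := by
  rw [left_unitality T.toFunctor, ← T.map_comp_assoc, Iso.hom_inv_id, T.map_id, Category.id_comp]

lemma δ_form_right (X : C) :
    δ T.toFunctor X (𝟙_ C) ≫ T.obj X ◁ Functor.OplaxMonoidal.η T.toFunctor =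
      T.map (ρ_ X).hom ≫ (ρ_ _).inv := by
  rw [right_unitality T.toFunctor, ← T.map_comp_assoc, Iso.hom_inv_id, T.map_id, Category.id_comp]

lemma map_mul_form : T.map (T.mul (𝟙_ C)) ≫ T.form = T.mul _ ≫ T.form := by
  rw [form, reassoc_of% T.map_mul_mul]

lemma contractL₀_congr {X : C} (f g : X ⟶ T.obj (𝟙_ C))
    (h : T.map f ≫ T.form = T.map g ≫ T.form) :
    T.map f ≫ T.contractL₀ = T.map g ≫ T.contractL₀ := by
  simp only [contractL₀, ← T.map_comp_assoc, rightUnitor_inv_naturality]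
  simp only [T.map_comp_assoc, contractL_congr f g h]

lemma contractR₀_congr {X : C} (f g : X ⟶ T.obj (𝟙_ C))
    (h : T.map f ≫ T.form = T.map g ≫ T.form) :
    T.map f ≫ T.contractR₀ = T.map g ≫ T.contractR₀ := by
  simp only [contractR₀, ← T.map_comp_assoc, leftUnitor_inv_naturality]
  simp only [T.map_comp_assoc, contractR_congr f g h]

/-- Counitality reduces `contractL₀ ≫ η` to `form`, and the unit law of the monad reduces `form` to
`η`. -/
lemma unit_contractL₀_η :
    T.unit _ ≫ T.contractL₀ ≫ Functor.OplaxMonoidal.η T.toFunctor =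
      Functor.OplaxMonoidal.η T.toFunctor := by
  have h : T.contractL₀ ≫ Functor.OplaxMonoidal.η T.toFunctor = T.form := by
    rw [contractL₀, contractL, Category.assoc, Category.assoc, Category.assoc,
      ← leftUnitor_naturality, ← whisker_exchange_assoc, reassoc_of% δ_form_right,
      ← T.map_comp_assoc]
    simp [-left_unitality, -right_unitality, unitors_equal]
  rw [h, form, T.unit_mul_assoc]

variable (T) in
/-- The idempotent on `T (𝟙_ C)` whose splitting is the unit algebra. -/
def unitIdem : T.obj (𝟙_ C) ⟶ T.obj (𝟙_ C) := T.unit _ ≫ T.contractL₀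

lemma unitIdem_η : T.unitIdem ≫ Functor.OplaxMonoidal.η T.toFunctor =
    Functor.OplaxMonoidal.η T.toFunctor := by
  rw [unitIdem, Category.assoc, unit_contractL₀_η]

/-- The action of the element `1` of the unit algebra on the left of `A`. -/
def leftContraction (A : T.Algebra) : T.obj (𝟙_ C) ⊗ A.A ⟶ A.A :=
  T.unit _ ≫ T.contractL A.A ≫ A.a

/-- The mirror image of `leftContraction`. -/
def rightContraction (A : T.Algebra) : A.A ⊗ T.obj (𝟙_ C) ⟶ A.A :=
  T.unit _ ≫ T.contractR A.A ≫ A.a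

lemma act_η_left (A : T.Algebra) :
    act (T.freeAlgebra (𝟙_ C)) A ≫ Functor.OplaxMonoidal.η T.toFunctor ▷ A.A ≫ (λ_ A.A).hom =
      T.contractL A.A ≫ A.a := by
  simp [act, contractL, form, tensorHom_def', whisker_exchange_assoc]

lemma act_η_right (A : T.Algebra) :
    act A (T.freeAlgebra (𝟙_ C)) ≫ A.A ◁ Functor.OplaxMonoidal.η T.toFunctor ≫ (ρ_ A.A).hom =
      T.contractR A.A ≫ A.a := by
  simp [act, contractR, form, MonoidalCategory.tensorHom_def, ← whisker_exchange_assoc]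

lemma idem_η_left (A : T.Algebra) :
    idem (T.freeAlgebra (𝟙_ C)) A ≫ Functor.OplaxMonoidal.η T.toFunctor ▷ A.A ≫ (λ_ A.A).hom =
      leftContraction A := by
  rw [idem, leftContraction, Category.assoc, act_η_left]

lemma idem_η_right (A : T.Algebra) :
    idem A (T.freeAlgebra (𝟙_ C)) ≫ A.A ◁ Functor.OplaxMonoidal.η T.toFunctor ≫ (ρ_ A.A).hom =
      rightContraction A := by
  rw [idem, rightContraction, Category.assoc, act_η_right]

lemma unit_leftContraction (A : T.Algebra) :
    T.unit (𝟙_ C) ▷ A.A ≫ leftContraction A = (λ_ A.A).hom := by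
  rw [leftContraction, reassoc_of% T.comp_unit, contractL, Category.assoc, Category.assoc,
    ← Functor.OplaxMonoidal.δ_natural_left_assoc, ← comp_whiskerRight_assoc, form,
    T.map_unit_mul_assoc, reassoc_of% δ_form_left, Iso.inv_hom_id_assoc, ← reassoc_of% T.comp_unit,
    unit_a, Category.comp_id]

lemma unit_rightContraction (A : T.Algebra) :
    A.A ◁ T.unit (𝟙_ C) ≫ rightContraction A = (ρ_ A.A).hom := by
  rw [rightContraction, reassoc_of% T.comp_unit, contractR, Category.assoc, Category.assoc,
    ← Functor.OplaxMonoidal.δ_natural_right_assoc, ← whiskerLeft_comp_assoc, form,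
    T.map_unit_mul_assoc, reassoc_of% δ_form_right, Iso.inv_hom_id_assoc, ← reassoc_of% T.comp_unit,
    unit_a, Category.comp_id]

namespace IsWeaklyBimonoidal

variable (h : T.IsWeaklyBimonoidal)
include h

lemma map_act_act (A B : T.Algebra) :
    T.map (act A B) ≫ act A B = T.mul _ ≫ act A B := by
  rw [act, T.map_comp, Category.assoc, ← δ_natural_assoc, tensorHom_comp_tensorHom, T.map_a_a,
    T.map_a_a, ← tensorHom_comp_tensorHom, reassoc_of% h.mul_δ]

lemma act_idem (A B : T.Algebra) : act A B ≫ idem A B = act A B := by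
  rw [idem, reassoc_of% T.comp_unit, h.map_act_act, T.unit_mul_assoc]

/-- This is `mul_δ` with the counit applied to the left leg. For `• ⊗ B` it is the formula `b b' =
ε(b₁ b'₁) b₂ b'₂`. -/
lemma mul_eq_left (Y : C) :
    T.map (T.map (λ_ Y).inv ≫ δ T.toFunctor (𝟙_ C) Y) ≫ T.contractL (T.obj Y) ≫ T.mul Y =
      T.mul Y := by
  have e := T.map (T.map (λ_ Y).inv) ≫= h.mul_δ (𝟙_ C) Y =≫
    (Functor.OplaxMonoidal.η T.toFunctor ▷ T.obj Y ≫ (λ_ _).hom)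
  simp only [Category.assoc, reassoc_of% δ_form_left, Iso.inv_hom_id, Category.comp_id,
    reassoc_of% T.map_map_mul] at e
  rw [← T.map_comp, Iso.inv_hom_id, T.map_id, Category.comp_id] at e
  rw [← act_η_left (T.freeAlgebra Y), T.map_comp_assoc, act, Category.assoc, ← e]

lemma mul_eq_right (X : C) :
    T.map (T.map (ρ_ X).inv ≫ δ T.toFunctor X (𝟙_ C)) ≫ T.contractR (T.obj X) ≫ T.mul X =
      T.mul X := by
  have e := T.map (T.map (ρ_ X).inv) ≫= h.mul_δ X (𝟙_ C) =≫
    (T.obj X ◁ Functor.OplaxMonoidal.η T.toFunctor ≫ (ρ_ _).hom)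
  simp only [Category.assoc, reassoc_of% δ_form_right, Iso.inv_hom_id, Category.comp_id,
    reassoc_of% T.map_map_mul] at e
  rw [← T.map_comp, Iso.inv_hom_id, T.map_id, Category.comp_id] at e
  rw [← act_η_right (T.freeAlgebra X), T.map_comp_assoc, act, Category.assoc, ← e]

/-- Contraction is a morphism of free algebras. Expand the outer product by `mul_eq_left` and move
the comultiplication past the contraction; the remaining `contractL₀` is seen only by `form`, so it
may be replaced by `mul`, and `mul_δ` reassembles the result. -/
lemma map_contractL_mul (Y : C) :
    T.map (T.contractL Y) ≫ T.mul Y = T.mul _ ≫ T.contractL Y := by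
  rw [← h.mul_eq_left Y, ← T.map_comp_assoc, contractL_δ, T.map_comp_assoc,
    reassoc_of% contractL_congr _ (T.mul _) (by rw [map_mul_form, h.form_contractL]) (T.obj Y),
    contractL, contractL, Category.assoc, Category.assoc,
    ← Functor.OplaxMonoidal.δ_natural_left_assoc, ← comp_whiskerRight_assoc, map_mul_form,
    reassoc_of% h.mul_δ, ← leftUnitor_naturality, ← whisker_exchange_assoc, tensorHom_def',
    form]
  simp

lemma map_contractR_mul (X : C) :
    T.map (T.contractR X) ≫ T.mul X = T.mul _ ≫ T.contractR X := by
  rw [← h.mul_eq_right X, ← T.map_comp_assoc, contractR_δ, T.map_comp_assoc,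
    reassoc_of% contractR_congr _ (T.mul _) (by rw [map_mul_form, h.form_contractR]) (T.obj X),
    contractR, contractR, Category.assoc, Category.assoc,
    ← Functor.OplaxMonoidal.δ_natural_right_assoc, ← whiskerLeft_comp_assoc, map_mul_form,
    reassoc_of% h.mul_δ, ← rightUnitor_naturality, whisker_exchange_assoc,
    MonoidalCategory.tensorHom_def, form]
  simp

lemma map_contractL₀_mul : T.map T.contractL₀ ≫ T.mul (𝟙_ C) = T.mul _ ≫ T.contractL₀ := by
  rw [contractL₀, T.map_comp_assoc, h.map_contractL_mul, reassoc_of% T.map_map_mul]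

lemma map_leftContraction_a (A : T.Algebra) :
    T.map (leftContraction A) ≫ A.a = T.contractL A.A ≫ A.a := by
  rw [leftContraction, T.map_comp_assoc, T.map_comp_assoc, T.map_a_a,
    reassoc_of% h.map_contractL_mul, T.map_unit_mul_assoc]

lemma map_rightContraction_a (A : T.Algebra) :
    T.map (rightContraction A) ≫ A.a = T.contractR A.A ≫ A.a := by
  rw [rightContraction, T.map_comp_assoc, T.map_comp_assoc, T.map_a_a,
    reassoc_of% h.map_contractR_mul, T.map_unit_mul_assoc]

/-- `unitIdem` depends on its argument only through `form`, which does not distinguish `mul` from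
`contractR₀`. For the same reason it does not distinguish `mul` from `contractL₀`. -/
lemma mul_unitIdem : T.mul (𝟙_ C) ≫ T.unitIdem = T.contractR₀ ≫ T.unitIdem := by
  rw [unitIdem, reassoc_of% T.comp_unit, reassoc_of% T.comp_unit]
  rw [contractL₀_congr (T.mul _) T.contractR₀ (by rw [map_mul_form, h.form_contractR])]

lemma contractL₀_unitIdem : T.contractL₀ ≫ T.unitIdem = T.mul (𝟙_ C) ≫ T.unitIdem := by
  rw [unitIdem, reassoc_of% T.comp_unit, reassoc_of% T.comp_unit]
  rw [contractL₀_congr (T.mul _) T.contractL₀ (by rw [map_mul_form, h.form_contractL])]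

/-- Since `contractL₀` is a morphism of algebras, multiplying by a projected element is the same as
applying `contractL₀`, and `unitIdem` sees this as plain multiplication. This is the associativity
needed to split off the unit algebra. -/
lemma map_unitIdem_mul_unitIdem :
    T.map T.unitIdem ≫ T.mul (𝟙_ C) ≫ T.unitIdem = T.mul _ ≫ T.unitIdem := by
  conv_lhs => enter [1]; rw [unitIdem]
  rw [T.map_comp_assoc, reassoc_of% h.map_contractL₀_mul, T.map_unit_mul_assoc]
  rw [← h.contractL₀_unitIdem]

lemma exists_unit [IsIdempotentComplete C] :
    ∃ R : T.Algebra, Nonempty (Presentation (T.mul (𝟙_ C) ≫ T.unitIdem) R) :=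
  exists_presentation _ <| by
    rw [T.map_comp_assoc, h.map_unitIdem_mul_unitIdem, reassoc_of% T.map_mul_mul]

lemma unit_contractR₀_unitIdem : T.unit _ ≫ T.contractR₀ ≫ T.unitIdem = T.unitIdem := by
  rw [← h.mul_unitIdem, T.unit_mul_assoc]

lemma mul_contractR₀_unitIdem :
    T.mul (𝟙_ C) ≫ T.unit _ ≫ T.contractR₀ = T.contractL₀ ≫ T.unit _ ≫ T.contractR₀ := by
  rw [reassoc_of% T.comp_unit, reassoc_of% T.comp_unit]
  rw [contractR₀_congr (T.mul _) T.contractL₀ (by rw [map_mul_form, h.form_contractL])]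

/-- The projected tensor product with `T K` factors through `A`, which is why the left unitor is
injective. Under `unitIdem` the product in the first factor may be replaced by `contractR₀`, and
`δ_contractR₀` then slides this contraction over to `A`. -/
lemma idem_unitIdem_left (A : T.Algebra) :
    idem (T.freeAlgebra (𝟙_ C)) A ≫ T.unitIdem ▷ A.A =
      leftContraction A ≫ (λ_ A.A).inv ≫ T.unit (𝟙_ C) ▷ A.A ≫
        idem (T.freeAlgebra (𝟙_ C)) A ≫ T.unitIdem ▷ A.A := by
  have e₁ : act (T.freeAlgebra (𝟙_ C)) A ≫ T.unitIdem ▷ A.A =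
      T.map (leftContraction A) ≫ T.map (λ_ A.A).inv ≫ δ T.toFunctor (𝟙_ C) A.A ≫
        (T.unitIdem ⊗ₘ A.a) := by
    have : δ T.toFunctor (T.obj (𝟙_ C)) A.A ≫ T.contractR₀ ▷ T.obj A.A ≫ (T.unitIdem ⊗ₘ A.a) =
        T.map (leftContraction A) ≫ T.map (λ_ A.A).inv ≫ δ T.toFunctor (𝟙_ C) A.A ≫
        (T.unitIdem ⊗ₘ A.a) := by
      rw [reassoc_of% δ_contractR₀, tensorHom_def', ← whiskerLeft_comp_assoc,
        ← h.map_leftContraction_a, whiskerLeft_comp_assoc,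
        Functor.OplaxMonoidal.δ_natural_right_assoc, ← T.map_comp_assoc, ← T.map_comp_assoc,
        leftUnitor_inv_naturality]
    rw [← this, act, Category.assoc]
    simp only [← tensorHom_id, tensorHom_comp_tensorHom, Category.comp_id, Category.id_comp,
      h.mul_unitIdem]
  have e₂ : T.unit (𝟙_ C) ▷ A.A ≫ idem (T.freeAlgebra (𝟙_ C)) A ≫ T.unitIdem ▷ A.A =
      T.unit _ ≫ δ T.toFunctor (𝟙_ C) A.A ≫ (T.unitIdem ⊗ₘ A.a) := by
    rw [idem, act, Category.assoc, reassoc_of% T.comp_unit, Category.assoc,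
      ← Functor.OplaxMonoidal.δ_natural_left_assoc]
    simp only [← tensorHom_id, tensorHom_comp_tensorHom, Category.comp_id, Category.id_comp,
      T.map_unit_mul_assoc]
  rw [e₂, idem, Category.assoc, e₁, ← reassoc_of% T.comp_unit, ← reassoc_of% T.comp_unit]

/-- The mirrored argument naturally produces the other idempotent `T.unit _ ≫ T.contractR₀`, whereas
the unit algebra is cut out by `unitIdem`. The two are reconciled at the end. -/
lemma idem_unitIdem_right (A : T.Algebra) :
    idem A (T.freeAlgebra (𝟙_ C)) ≫ A.A ◁ T.unitIdem =
      rightContraction A ≫ (ρ_ A.A).inv ≫ A.A ◁ T.unit (𝟙_ C) ≫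
        idem A (T.freeAlgebra (𝟙_ C)) ≫ A.A ◁ T.unitIdem := by
  have e₁ : act A (T.freeAlgebra (𝟙_ C)) ≫ A.A ◁ (T.unit _ ≫ T.contractR₀) =
      T.map (rightContraction A) ≫ T.map (ρ_ A.A).inv ≫ δ T.toFunctor A.A (𝟙_ C) ≫
        (A.a ⊗ₘ T.unit _ ≫ T.contractR₀) := by
    have : δ T.toFunctor A.A (T.obj (𝟙_ C)) ≫ T.obj A.A ◁ T.contractL₀ ≫
        (A.a ⊗ₘ T.unit _ ≫ T.contractR₀) =
        T.map (rightContraction A) ≫ T.map (ρ_ A.A).inv ≫ δ T.toFunctor A.A (𝟙_ C) ≫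
        (A.a ⊗ₘ T.unit _ ≫ T.contractR₀) := by
      rw [reassoc_of% δ_contractL₀, MonoidalCategory.tensorHom_def, ← comp_whiskerRight_assoc,
        ← h.map_rightContraction_a, comp_whiskerRight_assoc,
        Functor.OplaxMonoidal.δ_natural_left_assoc, ← T.map_comp_assoc, ← T.map_comp_assoc,
        rightUnitor_inv_naturality]
    rw [← this, act, Category.assoc]
    simp only [← id_tensorHom, tensorHom_comp_tensorHom, Category.comp_id, Category.id_comp,
      h.mul_contractR₀_unitIdem]
  have e₂ : A.A ◁ T.unit (𝟙_ C) ≫ idem A (T.freeAlgebra (𝟙_ C)) ≫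
        A.A ◁ (T.unit _ ≫ T.contractR₀) =
      T.unit _ ≫ δ T.toFunctor A.A (𝟙_ C) ≫ (A.a ⊗ₘ T.unit _ ≫ T.contractR₀) := by
    rw [idem, act, Category.assoc, reassoc_of% T.comp_unit, Category.assoc,
      ← Functor.OplaxMonoidal.δ_natural_right_assoc]
    simp only [← id_tensorHom, tensorHom_comp_tensorHom, Category.comp_id, Category.id_comp,
      T.map_unit_mul_assoc]
  have e₃ : idem A (T.freeAlgebra (𝟙_ C)) ≫ A.A ◁ (T.unit _ ≫ T.contractR₀) =
      rightContraction A ≫ (ρ_ A.A).inv ≫ A.A ◁ T.unit (𝟙_ C) ≫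
        idem A (T.freeAlgebra (𝟙_ C)) ≫ A.A ◁ (T.unit _ ≫ T.contractR₀) := by
    rw [e₂, idem, Category.assoc, e₁, ← reassoc_of% T.comp_unit, ← reassoc_of% T.comp_unit]
  -- The mirrored idempotent followed by `unitIdem` is `unitIdem`, by `unit_contractR₀_unitIdem`.
  have := e₃ =≫ A.A ◁ T.unitIdem
  simpa only [Category.assoc, ← whiskerLeft_comp, h.unit_contractR₀_unitIdem] using this

end IsWeaklyBimonoidal

end CategoryTheory.Monad

/-! ### Tensor product, unit and structure isomorphisms of algebras from chosen splittings. -/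

namespace CategoryTheory.Monad

open Functor.OplaxMonoidal

variable {C : Type u₁} [Category.{v₁} C] [MonoidalCategory C] {T : Monad C}
  [T.toFunctor.OplaxMonoidal]

namespace Presentation

variable {X : C} {x : T.obj X ⟶ X} {A : T.Algebra} (r : Presentation x A) (Z : C)

instance : IsSplitEpi (r.p ▷ Z) := ⟨⟨⟨r.i ▷ Z, by simp [← comp_whiskerRight]⟩⟩⟩

instance : IsSplitEpi (Z ◁ r.p) := ⟨⟨⟨Z ◁ r.i, by simp [← whiskerLeft_comp]⟩⟩⟩

end Presentation

variable (T) in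
/-- A choice of splittings of the idempotents that define the tensor product of algebras and the
unit algebra. -/
structure TensorData where
  /-- the tensor product of algebras -/
  tensor : T.Algebra → T.Algebra → T.Algebra
  /-- the unit algebra -/
  unit : T.Algebra
  /-- the splitting defining the tensor product -/
  pres (A B : T.Algebra) : Presentation (act A B) (tensor A B)
  /-- the splitting defining the unit -/
  unitPres : Presentation (T.mul (𝟙_ C) ≫ T.unitIdem) unit

lemma IsWeaklyBimonoidal.nonempty_tensorData [IsIdempotentComplete C]
    (h : T.IsWeaklyBimonoidal) : Nonempty (TensorData T) := by
  choose t r using fun A B : T.Algebra ↦ exists_presentation (act A B) (h.map_act_act A B)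
  obtain ⟨R, ⟨s⟩⟩ := h.exists_unit
  exact ⟨⟨t, R, fun A B ↦ (r A B).some, s⟩⟩

namespace TensorData

variable (D : TensorData T)

lemma p_i (A B : T.Algebra) : (D.pres A B).p ≫ (D.pres A B).i = idem A B :=
  (D.pres A B).p_i

/-- The tensor product of morphisms of algebras. -/
def map {A A' B B' : T.Algebra} (f : A ⟶ A') (g : B ⟶ B') : D.tensor A B ⟶ D.tensor A' B' :=
  (D.pres A B).hom (D.pres A' B') (f.f ⊗ₘ g.f) (act_naturality f g)

lemma p_map {A A' B B' : T.Algebra} (f : A ⟶ A') (g : B ⟶ B') :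
    (D.pres A B).p ≫ (D.map f g).f = (f.f ⊗ₘ g.f) ≫ (D.pres A' B').p :=
  Presentation.p_hom _ _ _ _

lemma map_i {A A' B B' : T.Algebra} (f : A ⟶ A') (g : B ⟶ B') :
    (D.map f g).f ≫ (D.pres A' B').i = (D.pres A B).i ≫ (f.f ⊗ₘ g.f) :=
  Presentation.hom_i _ _ _ _

lemma map_p_act_left (A B M : T.Algebra) :
    T.map ((D.pres A B).p ▷ M.A) ≫ act (D.tensor A B) M =
      actL A B M ≫ (D.pres A B).p ▷ M.A := by
  rw [show act (D.tensor A B) M = δ T.toFunctor _ _ ≫ ((D.tensor A B).a ⊗ₘ M.a) from rfl,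
    actL, ← Functor.OplaxMonoidal.δ_natural_left_assoc, Category.assoc, ← tensorHom_id,
    ← tensorHom_id, tensorHom_comp_tensorHom, tensorHom_comp_tensorHom,
    (D.pres A B).map_p_a, Category.id_comp, Category.comp_id]

lemma map_p_act_right (A B M : T.Algebra) :
    T.map (A.A ◁ (D.pres B M).p) ≫ act A (D.tensor B M) =
      actR A B M ≫ A.A ◁ (D.pres B M).p := by
  rw [show act A (D.tensor B M) = δ T.toFunctor _ _ ≫ (A.a ⊗ₘ (D.tensor B M).a) from rfl,
    actR, ← Functor.OplaxMonoidal.δ_natural_right_assoc, Category.assoc, ← id_tensorHom,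
    ← id_tensorHom, tensorHom_comp_tensorHom, tensorHom_comp_tensorHom,
    (D.pres B M).map_p_a, Category.id_comp, Category.comp_id]

/-- The presentation of a triple tensor product, bracketed to the left. -/
@[simps]
def presL (h : T.IsWeaklyBimonoidal) (A B M : T.Algebra) :
    Presentation (actL A B M) (D.tensor (D.tensor A B) M) where
  p := (D.pres A B).p ▷ M.A ≫ (D.pres _ M).p
  i := (D.pres _ M).i ≫ (D.pres A B).i ▷ M.A
  i_p := by simp [← comp_whiskerRight_assoc]
  p_i := by
    rw [Category.assoc, reassoc_of% p_i, idem, Category.assoc, reassoc_of% T.comp_unit,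
      reassoc_of% map_p_act_left,
      ← comp_whiskerRight, D.p_i, actL, Category.assoc, ← tensorHom_id, tensorHom_comp_tensorHom,
      h.act_idem, Category.comp_id]
  map_p_a := by
    rw [T.map_comp_assoc, (D.pres _ M).map_p_a, reassoc_of% map_p_act_left]

/-- The presentation of a triple tensor product, bracketed to the right. -/
@[simps]
def presR (h : T.IsWeaklyBimonoidal) (A B M : T.Algebra) :
    Presentation (actR A B M) (D.tensor A (D.tensor B M)) where
  p := A.A ◁ (D.pres B M).p ≫ (D.pres A _).p
  i := (D.pres A _).i ≫ A.A ◁ (D.pres B M).i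
  i_p := by simp [← whiskerLeft_comp_assoc]
  p_i := by
    rw [Category.assoc, reassoc_of% p_i, idem, Category.assoc, reassoc_of% T.comp_unit,
      reassoc_of% map_p_act_right,
      ← whiskerLeft_comp, D.p_i, actR, Category.assoc, ← id_tensorHom, tensorHom_comp_tensorHom,
      h.act_idem, Category.comp_id]
  map_p_a := by
    rw [T.map_comp_assoc, (D.pres A _).map_p_a, reassoc_of% map_p_act_right]

/-- The associator of algebras. -/
def associator (h : T.IsWeaklyBimonoidal) (A B M : T.Algebra) :
    D.tensor (D.tensor A B) M ≅ D.tensor A (D.tensor B M) :=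
  (D.presL h A B M).iso (D.presR h A B M) (α_ _ _ _) (actL_associator A B M)

lemma p_associator (h : T.IsWeaklyBimonoidal) (A B M : T.Algebra) :
    (D.pres A B).p ▷ M.A ≫ (D.pres _ M).p ≫ (D.associator h A B M).hom.f =
      (α_ _ _ _).hom ≫ A.A ◁ (D.pres B M).p ≫ (D.pres A _).p := by
  have := (D.presL h A B M).p_hom (D.presR h A B M) (α_ _ _ _).hom (actL_associator A B M)
  simp only [presL_p, presR_p, Category.assoc] at this
  exact this

lemma associator_i (h : T.IsWeaklyBimonoidal) (A B M : T.Algebra) :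
    (D.associator h A B M).hom.f ≫ (D.pres A _).i ≫ A.A ◁ (D.pres B M).i =
      (D.pres _ M).i ≫ (D.pres A B).i ▷ M.A ≫ (α_ _ _ _).hom := by
  have := (D.presL h A B M).hom_i (D.presR h A B M) (α_ _ _ _).hom (actL_associator A B M)
  simp only [presL_i, presR_i, Category.assoc] at this
  exact this

/-- The unit constraint `K ⟶ R`. -/
def ε : 𝟙_ C ⟶ D.unit.A := T.unit _ ≫ D.unitPres.p

/-- The counit constraint `R ⟶ K`. -/
def η : D.unit.A ⟶ 𝟙_ C := D.unitPres.i ≫ Functor.OplaxMonoidal.η T.toFunctor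

lemma unit_p_i : D.unitPres.p ≫ D.unitPres.i = T.unitIdem := by
  rw [D.unitPres.p_i, T.unit_mul_assoc]

lemma unitIdem_p : T.unitIdem ≫ D.unitPres.p = D.unitPres.p := by
  have := D.unit_p_i =≫ D.unitPres.p
  rw [Category.assoc, D.unitPres.i_p, Category.comp_id] at this
  exact this.symm

lemma unit_p_η : D.unitPres.p ≫ D.η = Functor.OplaxMonoidal.η T.toFunctor := by
  rw [η, reassoc_of% unit_p_i, unitIdem_η]

/-- The projection of the free algebra on the unit object onto the unit algebra. -/
@[simps]
def unitProj : T.freeAlgebra (𝟙_ C) ⟶ D.unit where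
  f := D.unitPres.p
  h := by rw [D.unitPres.map_p_a, Category.assoc, unitIdem_p]

lemma idem_unit_left (A : T.Algebra) :
    idem (T.freeAlgebra (𝟙_ C)) A ≫ D.unitPres.p ▷ A.A = D.unitPres.p ▷ A.A ≫ idem D.unit A := by
  simpa only [tensorHom_id, unitProj_f, Algebra.id_f] using idem_naturality D.unitProj (𝟙 A)

lemma idem_unit_right (A : T.Algebra) :
    idem A (T.freeAlgebra (𝟙_ C)) ≫ A.A ◁ D.unitPres.p = A.A ◁ D.unitPres.p ≫ idem A D.unit := by
  simpa only [id_tensorHom, unitProj_f, Algebra.id_f] using idem_naturality (𝟙 A) D.unitProj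

lemma p_leftUnitor (A : T.Algebra) :
    D.unitPres.p ▷ A.A ≫ (D.pres D.unit A).p ≫ (D.pres D.unit A).i ≫ D.η ▷ A.A ≫ (λ_ _).hom =
      leftContraction A := by
  rw [reassoc_of% D.p_i, ← reassoc_of% idem_unit_left, ← comp_whiskerRight_assoc, unit_p_η,
    idem_η_left]

lemma p_rightUnitor (A : T.Algebra) :
    A.A ◁ D.unitPres.p ≫ (D.pres A D.unit).p ≫ (D.pres A D.unit).i ≫ A.A ◁ D.η ≫ (ρ_ _).hom =
      rightContraction A := by
  rw [reassoc_of% D.p_i, ← reassoc_of% idem_unit_right, ← whiskerLeft_comp_assoc, unit_p_η,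
    idem_η_right]

variable (h : T.IsWeaklyBimonoidal)

-- The factorization `idem_unitIdem_left` carried to the splittings; it supplies the half of the
-- invertibility of the left unitor that does not follow from counitality.
include h in
lemma p_eq_left (A : T.Algebra) :
    D.unitPres.p ▷ A.A ≫ (D.pres D.unit A).p =
      leftContraction A ≫ (λ_ A.A).inv ≫ D.ε ▷ A.A ≫ (D.pres D.unit A).p := by
  have e := h.idem_unitIdem_left A =≫ D.unitPres.p ▷ A.A
  simp only [Category.assoc, ← comp_whiskerRight, unitIdem_p] at e
  rw [idem_unit_left] at e
  simp only [← D.p_i] at e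
  have := e =≫ (D.pres D.unit A).p
  simpa only [ε, Category.assoc, Presentation.i_p, Category.comp_id, comp_whiskerRight] using this

include h in
lemma p_eq_right (A : T.Algebra) :
    A.A ◁ D.unitPres.p ≫ (D.pres A D.unit).p =
      rightContraction A ≫ (ρ_ A.A).inv ≫ A.A ◁ D.ε ≫ (D.pres A D.unit).p := by
  have e := h.idem_unitIdem_right A =≫ A.A ◁ D.unitPres.p
  simp only [Category.assoc, ← whiskerLeft_comp, unitIdem_p] at e
  rw [idem_unit_right] at e
  simp only [← D.p_i] at e
  have := e =≫ (D.pres A D.unit).p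
  simpa only [ε, Category.assoc, Presentation.i_p, Category.comp_id, whiskerLeft_comp] using this

/-- The left unitor of algebras. -/
@[simps! hom_f inv_f]
def leftUnitor (A : T.Algebra) : D.tensor D.unit A ≅ A :=
  Algebra.isoMk
    { hom := (D.pres D.unit A).i ≫ D.η ▷ A.A ≫ (λ_ _).hom
      inv := (λ_ _).inv ≫ D.ε ▷ A.A ≫ (D.pres D.unit A).p
      hom_inv_id := by
        rw [← cancel_epi (D.pres D.unit A).p, ← cancel_epi (D.unitPres.p ▷ A.A), Category.comp_id,
          D.p_eq_left h, ← D.p_leftUnitor]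
        simp only [Category.assoc]
      inv_hom_id := by
        simp only [Category.assoc]
        rw [ε, comp_whiskerRight_assoc, p_leftUnitor, unit_leftContraction, Iso.inv_hom_id] }
    (by
      dsimp only
      -- Linearity is tested after two split epimorphisms, which replace the unit algebra by the
      -- free algebra on the unit object; there the composite is a contraction.
      rw [← cancel_epi (T.map (D.pres D.unit A).p), reassoc_of% (D.pres D.unit A).map_p_a,
        ← cancel_epi (T.map (D.unitPres.p ▷ A.A)), ← T.map_comp_assoc, ← T.map_comp_assoc,
        Category.assoc, p_leftUnitor, h.map_leftContraction_a, reassoc_of% D.p_i,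
        reassoc_of% h.act_idem, ← act_η_left, ← D.unit_p_η, comp_whiskerRight_assoc]
      have := act_naturality D.unitProj (𝟙 A)
      simp only [tensorHom_id, unitProj_f, Algebra.id_f] at this
      rw [reassoc_of% this])

/-- The right unitor of algebras. -/
@[simps! hom_f inv_f]
def rightUnitor (A : T.Algebra) : D.tensor A D.unit ≅ A :=
  Algebra.isoMk
    { hom := (D.pres A D.unit).i ≫ A.A ◁ D.η ≫ (ρ_ _).hom
      inv := (ρ_ _).inv ≫ A.A ◁ D.ε ≫ (D.pres A D.unit).p
      hom_inv_id := by
        rw [← cancel_epi (D.pres A D.unit).p, ← cancel_epi (A.A ◁ D.unitPres.p), Category.comp_id,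
          D.p_eq_right h, ← D.p_rightUnitor]
        simp only [Category.assoc]
      inv_hom_id := by
        simp only [Category.assoc]
        rw [ε, whiskerLeft_comp_assoc, p_rightUnitor, unit_rightContraction, Iso.inv_hom_id] }
    (by
      dsimp only
      rw [← cancel_epi (T.map (D.pres A D.unit).p), reassoc_of% (D.pres A D.unit).map_p_a,
        ← cancel_epi (T.map (A.A ◁ D.unitPres.p)), ← T.map_comp_assoc, ← T.map_comp_assoc,
        Category.assoc, p_rightUnitor, h.map_rightContraction_a, reassoc_of% D.p_i,
        reassoc_of% h.act_idem, ← act_η_right, ← D.unit_p_η, whiskerLeft_comp_assoc]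
      have := act_naturality (𝟙 A) D.unitProj
      simp only [id_tensorHom, unitProj_f, Algebra.id_f] at this
      rw [reassoc_of% this])

end TensorData

end CategoryTheory.Monad

/-! ### Coherence, the Frobenius laws, and the resulting weak bimonad. -/

namespace CategoryTheory.Monad

variable {C : Type u₁} [Category.{v₁} C] [MonoidalCategory C] {T : Monad C}
  [T.toFunctor.OplaxMonoidal]

namespace TensorData

variable (D : TensorData T) (h : T.IsWeaklyBimonoidal)

lemma hom_ext₃ {A B M N : T.Algebra} {f g : D.tensor (D.tensor A B) M ⟶ N}
    (e : (D.pres A B).p ▷ M.A ≫ (D.pres _ M).p ≫ f.f =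
      (D.pres A B).p ▷ M.A ≫ (D.pres _ M).p ≫ g.f) : f = g :=
  (D.pres _ M).hom_ext ((cancel_epi _).1 e)

lemma hom_ext₄ {A B M M' N : T.Algebra} {f g : D.tensor (D.tensor (D.tensor A B) M) M' ⟶ N}
    (e : (D.pres A B).p ▷ M.A ▷ M'.A ≫ (D.pres _ M).p ▷ M'.A ≫ (D.pres _ M').p ≫ f.f =
      (D.pres A B).p ▷ M.A ▷ M'.A ≫ (D.pres _ M).p ▷ M'.A ≫ (D.pres _ M').p ≫ g.f) : f = g := by
  have : IsSplitEpi ((D.pres A B).p ▷ M.A ▷ M'.A) :=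
    ⟨⟨⟨(D.pres A B).i ▷ M.A ▷ M'.A, by simp [← comp_whiskerRight]⟩⟩⟩
  exact D.hom_ext₃ ((cancel_epi _).1 e)

@[simp]
lemma p_map_id_left {A B B' : T.Algebra} (g : B ⟶ B') :
    (D.pres A B).p ≫ (D.map (𝟙 A) g).f = A.A ◁ g.f ≫ (D.pres A B').p := by
  rw [p_map, Algebra.id_f, id_tensorHom]

@[simp]
lemma p_map_id_right {A A' B : T.Algebra} (f : A ⟶ A') :
    (D.pres A B).p ≫ (D.map f (𝟙 B)).f = f.f ▷ B.A ≫ (D.pres A' B).p := by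
  rw [p_map, Algebra.id_f, tensorHom_id]

@[simp]
lemma map_id_left_i {A B B' : T.Algebra} (g : B ⟶ B') :
    (D.map (𝟙 A) g).f ≫ (D.pres A B').i = (D.pres A B).i ≫ A.A ◁ g.f := by
  rw [map_i, Algebra.id_f, id_tensorHom]

@[simp]
lemma map_id_right_i {A A' B : T.Algebra} (f : A ⟶ A') :
    (D.map f (𝟙 B)).f ≫ (D.pres A' B).i = (D.pres A B).i ≫ f.f ▷ B.A := by
  rw [map_i, Algebra.id_f, tensorHom_id]

lemma ε_p_leftUnitor (A : T.Algebra) :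
    D.ε ▷ A.A ≫ (D.pres D.unit A).p ≫ (D.leftUnitor h A).hom.f = (λ_ A.A).hom := by
  rw [leftUnitor_hom_f, ε, comp_whiskerRight_assoc, D.p_leftUnitor, unit_leftContraction]

lemma ε_p_rightUnitor (A : T.Algebra) :
    A.A ◁ D.ε ≫ (D.pres A D.unit).p ≫ (D.rightUnitor h A).hom.f = (ρ_ A.A).hom := by
  rw [rightUnitor_hom_f, ε, whiskerLeft_comp_assoc, D.p_rightUnitor, unit_rightContraction]

/-- Precomposition with `ρ⁻¹ ⊗ B` is injective. -/
lemma map_rightUnitor_injective (A B : T.Algebra) {M : T.Algebra} :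
    Function.Injective fun f : D.tensor (D.tensor A D.unit) B ⟶ M ↦
      D.map (D.rightUnitor h A).inv (𝟙 B) ≫ f := fun f g e ↦ by
  have e' : D.map (D.rightUnitor h A).hom (𝟙 B) ≫ D.map (D.rightUnitor h A).inv (𝟙 B) = 𝟙 _ :=
    (D.pres _ _).hom_ext <| by
      rw [Algebra.comp_f, reassoc_of% D.p_map_id_right, p_map_id_right, ← comp_whiskerRight_assoc,
        ← Algebra.comp_f, Iso.hom_inv_id]
      simp
  simpa [reassoc_of% e'] using D.map (D.rightUnitor h A).hom (𝟙 B) ≫= e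

/-- The monoidal structure on the category of algebras. -/
@[reducible]
def monoidalCategory : MonoidalCategory T.Algebra where
  tensorObj := D.tensor
  whiskerLeft A _ _ f := D.map (𝟙 A) f
  whiskerRight f B := D.map f (𝟙 B)
  tensorHom := D.map
  tensorUnit := D.unit
  associator := D.associator h
  leftUnitor := D.leftUnitor h
  rightUnitor := D.rightUnitor h
  tensorHom_def f g := (D.pres _ _).hom_ext <| by
    rw [Algebra.comp_f, reassoc_of% D.p_map_id_right, p_map_id_left, p_map, tensorHom_def_assoc]
  id_tensorHom_id A B := (D.pres _ _).hom_ext <| by simp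
  tensorHom_comp_tensorHom f₁ f₂ g₁ g₂ := (D.pres _ _).hom_ext <| by
    simp [p_map, reassoc_of% p_map]
  whiskerLeft_id A B := (D.pres _ _).hom_ext <| by simp
  id_whiskerRight A B := (D.pres _ _).hom_ext <| by simp
  associator_naturality {A₁ A₂ A₃ B₁ B₂ B₃} f₁ f₂ f₃ := D.hom_ext₃ <| by
    have e₁ : (D.pres A₁ A₂).p ▷ A₃.A ≫ ((D.map f₁ f₂).f ⊗ₘ f₃.f) =
        ((f₁.f ⊗ₘ f₂.f) ⊗ₘ f₃.f) ≫ (D.pres B₁ B₂).p ▷ B₃.A := by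
      rw [← tensorHom_id, ← tensorHom_id, tensorHom_comp_tensorHom, tensorHom_comp_tensorHom,
        p_map, Category.id_comp, Category.comp_id]
    have e₂ : A₁.A ◁ (D.pres A₂ A₃).p ≫ (f₁.f ⊗ₘ (D.map f₂ f₃).f) =
        (f₁.f ⊗ₘ f₂.f ⊗ₘ f₃.f) ≫ B₁.A ◁ (D.pres B₂ B₃).p := by
      rw [← id_tensorHom, ← id_tensorHom, tensorHom_comp_tensorHom, tensorHom_comp_tensorHom,
        p_map, Category.id_comp, Category.comp_id]
    rw [Algebra.comp_f, Algebra.comp_f, reassoc_of% p_map, reassoc_of% p_associator, p_map,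
      reassoc_of% e₁, reassoc_of% e₂, p_associator, associator_naturality_assoc]
  leftUnitor_naturality {A B} f := by
    -- Precomposing with the inverse replaces a general element of the unit algebra by the point
    -- `D.ε`, on which the unitor is that of the base category.
    rw [← cancel_epi (D.leftUnitor h A).inv, Iso.inv_hom_id_assoc]
    ext
    simp only [Algebra.comp_f, leftUnitor_inv_f, Category.assoc, reassoc_of% D.p_map_id_left]
    rw [← whisker_exchange_assoc, ε_p_leftUnitor]
    simp
  rightUnitor_naturality {A B} f := by
    rw [← cancel_epi (D.rightUnitor h A).inv, Iso.inv_hom_id_assoc]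
    ext
    simp only [Algebra.comp_f, rightUnitor_inv_f, Category.assoc, reassoc_of% D.p_map_id_right]
    rw [whisker_exchange_assoc, ε_p_rightUnitor]
    simp
  pentagon A₁ A₂ A₃ A₄ := D.hom_ext₄ <| by
    simp only [Algebra.comp_f, reassoc_of% D.p_map_id_right]
    rw [← comp_whiskerRight_assoc, ← comp_whiskerRight_assoc, Category.assoc, p_associator,
      comp_whiskerRight_assoc, comp_whiskerRight_assoc, reassoc_of% p_associator, p_map_id_left,
      associator_naturality_middle_assoc, ← whiskerLeft_comp_assoc, ← whiskerLeft_comp_assoc,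
      Category.assoc, p_associator, reassoc_of% p_associator, associator_naturality_left_assoc,
      ← whisker_exchange_assoc, p_associator, associator_naturality_right_assoc]
    simp
  -- Inserting the inverse right unitor puts the point `D.ε` in the middle slot, where both unitors
  -- reduce to those of the base category; its triangle identity then finishes.
  triangle A B := (D.map_rightUnitor_injective h A B) <| (D.pres _ _).hom_ext <| by
    simp only [Algebra.comp_f, reassoc_of% D.p_map_id_right, rightUnitor_inv_f, comp_whiskerRight,
      Category.assoc, reassoc_of% p_associator, p_map_id_left]
    have e : A.A ◁ D.ε ▷ B.A ≫ A.A ◁ (D.pres D.unit B).p ≫ A.A ◁ (D.leftUnitor h B).hom.f =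
        A.A ◁ (λ_ B.A).hom := by
      rw [← whiskerLeft_comp, ← whiskerLeft_comp, ε_p_leftUnitor]
    have e' : A.A ◁ D.ε ≫ (D.pres A D.unit).p ≫ (D.rightUnitor h A).hom.f = (ρ_ A.A).hom :=
      D.ε_p_rightUnitor h A
    rw [associator_naturality_middle_assoc, reassoc_of% e, p_map_id_right,
      ← comp_whiskerRight_assoc (D.pres A D.unit).p, ← comp_whiskerRight_assoc,
      ← comp_whiskerRight_assoc, Category.assoc, e']
    simp

/-- The Frobenius law is `idem_left_right` read through the splittings: precomposing with a
retraction and cancelling a section turns one into the other. -/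
lemma p_associator_hom_i (A B M : T.Algebra) :
    (D.pres _ M).p ≫ (D.associator h A B M).hom.f ≫ (D.pres A _).i =
      (D.pres A B).i ▷ M.A ≫ (α_ _ _ _).hom ≫ A.A ◁ (D.pres B M).p := by
  have e := h.idem_left_right A B M =≫ A.A ◁ (D.pres B M).p
  simp only [Category.assoc, ← whiskerLeft_comp] at e
  rw [← D.p_i B M, Category.assoc, (D.pres B M).i_p, Category.comp_id, reassoc_of% actL_associator,
    ← map_p_act_right, ← reassoc_of% T.comp_unit, ← reassoc_of% T.comp_unit] at e
  rw [← cancel_epi ((D.pres A B).p ▷ M.A), reassoc_of% p_associator, D.p_i, idem, ← e, ← D.p_i]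
  simp

lemma p_associator_inv_i (A B M : T.Algebra) :
    (D.pres A _).p ≫ (D.associator h A B M).inv.f ≫ (D.pres _ M).i =
      A.A ◁ (D.pres B M).i ≫ (α_ _ _ _).inv ≫ (D.pres A B).p ▷ M.A := by
  have e := h.idem_right_left A B M =≫ (D.pres A B).p ▷ M.A
  have e' : actR A B M ≫ (α_ _ _ _).inv = T.map (α_ _ _ _).inv ≫ actL A B M := by
    rw [Iso.comp_inv_eq, Category.assoc, actL_associator, ← T.map_comp_assoc, Iso.inv_hom_id,
      T.map_id, Category.id_comp]
  have e'' : A.A ◁ (D.pres B M).p ≫ (D.pres A _).p ≫ (D.associator h A B M).inv.f =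
      (α_ _ _ _).inv ≫ (D.pres A B).p ▷ M.A ≫ (D.pres _ M).p := by
    have : (D.associator h A B M).hom.f ≫ (D.associator h A B M).inv.f = 𝟙 _ :=
      congrArg Algebra.Hom.f (D.associator h A B M).hom_inv_id
    have := (α_ _ _ _).inv ≫= D.p_associator h A B M =≫ (D.associator h A B M).inv.f
    simp_all
  simp only [Category.assoc, ← comp_whiskerRight] at e
  rw [← D.p_i A B, Category.assoc, (D.pres A B).i_p, Category.comp_id, reassoc_of% e',
    ← map_p_act_left, ← reassoc_of% T.comp_unit, ← reassoc_of% T.comp_unit] at e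
  rw [← cancel_epi (A.A ◁ (D.pres B M).p), reassoc_of% e'', D.p_i, idem, ← e, ← D.p_i]
  simp

lemma leftUnitor_inv_i (A : T.Algebra) :
    (D.leftUnitor h A).inv.f ≫ (D.pres D.unit A).i ≫ D.η ▷ A.A = (λ_ A.A).inv := by
  have : (D.leftUnitor h A).inv.f ≫ (D.leftUnitor h A).hom.f = 𝟙 _ :=
    congrArg Algebra.Hom.f (D.leftUnitor h A).inv_hom_id
  rw [leftUnitor_hom_f] at this
  rw [← cancel_mono (λ_ A.A).hom, Category.assoc, Category.assoc, this, Iso.inv_hom_id]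

lemma rightUnitor_inv_i (A : T.Algebra) :
    (D.rightUnitor h A).inv.f ≫ (D.pres A D.unit).i ≫ A.A ◁ D.η = (ρ_ A.A).inv := by
  have : (D.rightUnitor h A).inv.f ≫ (D.rightUnitor h A).hom.f = 𝟙 _ :=
    congrArg Algebra.Hom.f (D.rightUnitor h A).inv_hom_id
  rw [rightUnitor_hom_f] at this
  rw [← cancel_mono (ρ_ A.A).hom, Category.assoc, Category.assoc, this, Iso.inv_hom_id]

/-- The weak bimonad structure obtained from a choice of splittings. -/
@[reducible]
def weakBimonad : WeakBimonad T where
  monoidal := D.monoidalCategory h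
  frobenius :=
    letI := D.monoidalCategory h
    { ε := D.ε
      μ A B := (D.pres A B).p
      μ_natural_left f _ := (D.p_map_id_right f).symm
      μ_natural_right _ g := (D.p_map_id_left g).symm
      associativity A B M := D.p_associator h A B M
      left_unitality A := (D.ε_p_leftUnitor h A).symm
      right_unitality A := (D.ε_p_rightUnitor h A).symm
      η := D.η
      δ A B := (D.pres A B).i
      δ_natural_left f _ := (D.map_id_right_i f).symm
      δ_natural_right _ g := (D.map_id_left_i g).symm
      oplax_associativity A B M := (D.associator_i h A B M).symm
      oplax_left_unitality A := (D.leftUnitor_inv_i h A).symm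
      oplax_right_unitality A := (D.rightUnitor_inv_i h A).symm
      frobenius_left := D.p_associator_inv_i h
      frobenius_right := D.p_associator_hom_i h
      separable A B := (D.pres A B).i_p }

lemma weakBimonad_tau₀ : (D.weakBimonad h).tau₀ = Functor.OplaxMonoidal.η T.toFunctor := by
  change T.map D.ε ≫ D.unit.a ≫ D.η = _
  rw [ε, T.map_comp_assoc, reassoc_of% D.unitPres.map_p_a,
    T.map_unit_mul_assoc, unit_p_η, unitIdem_η]

/-- The idempotent `p ≫ i` is absorbed by the action, and the free actions cancel the units, so only
`δ` remains. -/
lemma weakBimonad_tau (X Y : C) :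
    (D.weakBimonad h).tau X Y = Functor.OplaxMonoidal.δ T.toFunctor X Y := by
  change T.map (T.unit X ⊗ₘ T.unit Y) ≫ T.map (D.pres (T.freeAlgebra X) (T.freeAlgebra Y)).p ≫
    (D.tensor (T.freeAlgebra X) (T.freeAlgebra Y)).a ≫
      (D.pres (T.freeAlgebra X) (T.freeAlgebra Y)).i = _
  rw [reassoc_of% (D.pres _ _).map_p_a, D.p_i, h.act_idem]
  change T.map (T.unit X ⊗ₘ T.unit Y) ≫ Functor.OplaxMonoidal.δ T.toFunctor _ _ ≫
    (T.mul X ⊗ₘ T.mul Y) = _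
  rw [← Functor.OplaxMonoidal.δ_natural_assoc, tensorHom_comp_tensorHom, T.map_unit_mul,
    T.map_unit_mul, id_tensorHom_id, Category.comp_id]

end TensorData

/-- A compatible opmonoidal structure underlies a weak bimonad. -/
lemma IsWeaklyBimonoidal.exists_weakBimonad [IsIdempotentComplete C]
    (h : T.IsWeaklyBimonoidal) :
    ∃ W : WeakBimonad T, W.opmonoidal = ‹T.toFunctor.OplaxMonoidal› := by
  obtain ⟨D⟩ := h.nonempty_tensorData
  refine ⟨D.weakBimonad h, Functor.OplaxMonoidal.ext (D.weakBimonad_tau₀ h) ?_⟩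
  funext X Y
  exact D.weakBimonad_tau h X Y

end CategoryTheory.Monad

/-! ### From a weak bimonad back to the compatibility conditions. -/

namespace WeakBimonad

open CategoryTheory.Monad

variable {C : Type u₁} [Category.{v₁} C] [MonoidalCategory C] {T : Monad C} (W : WeakBimonad T)

/-- The tensor product of algebras. -/
def tensor (A B : T.Algebra) : T.Algebra :=
  letI := W.monoidal
  A ⊗ B

/-- The unit algebra. -/
def unit : T.Algebra :=
  letI := W.monoidal
  𝟙_ T.Algebra

/-- Left whiskering of algebra morphisms. -/
def whiskerLeft (A : T.Algebra) {B B' : T.Algebra} (g : B ⟶ B') : W.tensor A B ⟶ W.tensor A B' :=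
  letI := W.monoidal
  A ◁ g

/-- Right whiskering of algebra morphisms. -/
def whiskerRight {A A' : T.Algebra} (f : A ⟶ A') (B : T.Algebra) : W.tensor A B ⟶ W.tensor A' B :=
  letI := W.monoidal
  f ▷ B

/-- The associator of algebras. -/
def associator (A B M : T.Algebra) :
    W.tensor (W.tensor A B) M ≅ W.tensor A (W.tensor B M) :=
  letI := W.monoidal
  α_ A B M

/-- The left unitor of algebras. -/
def leftUnitor (A : T.Algebra) : W.tensor W.unit A ≅ A :=
  letI := W.monoidal
  λ_ A

/-- The right unitor of algebras. -/
def rightUnitor (A : T.Algebra) : W.tensor A W.unit ≅ A :=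
  letI := W.monoidal
  ρ_ A

/-- The binary part of the monoidal structure on the forgetful functor. -/
def p (A B : T.Algebra) : A.A ⊗ B.A ⟶ (W.tensor A B).A := W.frobenius.μ A B

/-- The binary part of the opmonoidal structure on the forgetful functor. -/
def i (A B : T.Algebra) : (W.tensor A B).A ⟶ A.A ⊗ B.A := W.frobenius.δ A B

/-- The nullary part of the monoidal structure on the forgetful functor. -/
def p₀ : 𝟙_ C ⟶ W.unit.A := W.frobenius.ε

/-- The nullary part of the opmonoidal structure on the forgetful functor. -/
def i₀ : W.unit.A ⟶ 𝟙_ C := W.frobenius.η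

@[simp]
lemma i_p (A B : T.Algebra) : W.i A B ≫ W.p A B = 𝟙 _ :=
  letI := W.monoidal
  W.frobenius.separable A B

lemma whiskerRight_p {A A' : T.Algebra} (f : A ⟶ A') (B : T.Algebra) :
    f.f ▷ B.A ≫ W.p A' B = W.p A B ≫ (W.whiskerRight f B).f :=
  W.frobenius.μ_natural_left f B

lemma whiskerLeft_p (A : T.Algebra) {B B' : T.Algebra} (g : B ⟶ B') :
    A.A ◁ g.f ≫ W.p A B' = W.p A B ≫ (W.whiskerLeft A g).f :=
  W.frobenius.μ_natural_right A g

lemma i_whiskerRight {A A' : T.Algebra} (f : A ⟶ A') (B : T.Algebra) :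
    W.i A B ≫ f.f ▷ B.A = (W.whiskerRight f B).f ≫ W.i A' B :=
  W.frobenius.δ_natural_left f B

lemma i_whiskerLeft (A : T.Algebra) {B B' : T.Algebra} (g : B ⟶ B') :
    W.i A B ≫ A.A ◁ g.f = (W.whiskerLeft A g).f ≫ W.i A B' :=
  W.frobenius.δ_natural_right A g

lemma p_associator (A B M : T.Algebra) :
    W.p A B ▷ M.A ≫ W.p _ M ≫ (W.associator A B M).hom.f =
      (α_ _ _ _).hom ≫ A.A ◁ W.p B M ≫ W.p A _ :=
  W.frobenius.associativity A B M

lemma associator_i (A B M : T.Algebra) :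
    W.i _ M ≫ W.i A B ▷ M.A ≫ (α_ _ _ _).hom =
      (W.associator A B M).hom.f ≫ W.i A _ ≫ A.A ◁ W.i B M :=
  W.frobenius.oplax_associativity A B M

lemma p_leftUnitor (A : T.Algebra) :
    W.p₀ ▷ A.A ≫ W.p _ A ≫ (W.leftUnitor A).hom.f = (λ_ A.A).hom :=
  (W.frobenius.left_unitality A).symm

lemma p_rightUnitor (A : T.Algebra) :
    A.A ◁ W.p₀ ≫ W.p A _ ≫ (W.rightUnitor A).hom.f = (ρ_ A.A).hom :=
  (W.frobenius.right_unitality A).symm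

lemma i_leftUnitor (A : T.Algebra) :
    W.i _ A ≫ W.i₀ ▷ A.A ≫ (λ_ A.A).hom = (W.leftUnitor A).hom.f := by
  have e : (λ_ A.A).inv = (W.leftUnitor A).inv.f ≫ W.i _ A ≫ W.i₀ ▷ A.A :=
    W.frobenius.oplax_left_unitality A
  have e' : (W.leftUnitor A).hom.f ≫ (W.leftUnitor A).inv.f = 𝟙 _ :=
    congrArg Algebra.Hom.f (W.leftUnitor A).hom_inv_id
  have := (W.leftUnitor A).hom.f ≫= e
  rw [reassoc_of% e', Iso.comp_inv_eq] at this
  rw [this, Category.assoc]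

lemma i_rightUnitor (A : T.Algebra) :
    W.i A _ ≫ A.A ◁ W.i₀ ≫ (ρ_ A.A).hom = (W.rightUnitor A).hom.f := by
  have e : (ρ_ A.A).inv = (W.rightUnitor A).inv.f ≫ W.i A _ ≫ A.A ◁ W.i₀ :=
    W.frobenius.oplax_right_unitality A
  have e' : (W.rightUnitor A).hom.f ≫ (W.rightUnitor A).inv.f = 𝟙 _ :=
    congrArg Algebra.Hom.f (W.rightUnitor A).hom_inv_id
  have := (W.rightUnitor A).hom.f ≫= e
  rw [reassoc_of% e', Iso.comp_inv_eq] at this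
  rw [this, Category.assoc]

lemma leftUnitor_naturality {A B : T.Algebra} (f : A ⟶ B) :
    (W.whiskerLeft W.unit f).f ≫ (W.leftUnitor B).hom.f = (W.leftUnitor A).hom.f ≫ f.f :=
  letI := W.monoidal
  congrArg Algebra.Hom.f (MonoidalCategory.leftUnitor_naturality f)

lemma rightUnitor_naturality {A B : T.Algebra} (f : A ⟶ B) :
    (W.whiskerRight f W.unit).f ≫ (W.rightUnitor B).hom.f = (W.rightUnitor A).hom.f ≫ f.f :=
  letI := W.monoidal
  congrArg Algebra.Hom.f (MonoidalCategory.rightUnitor_naturality f)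

lemma leftUnitor_unit : W.leftUnitor W.unit = W.rightUnitor W.unit := by
  let := W.monoidal
  ext : 1
  exact unitors_equal

lemma p_associator_inv_i (A B M : T.Algebra) :
    W.p A _ ≫ (W.associator A B M).inv.f ≫ W.i _ M =
      A.A ◁ W.i B M ≫ (α_ _ _ _).inv ≫ W.p A B ▷ M.A :=
  letI := W.monoidal
  W.frobenius.frobenius_left A B M

lemma p_associator_hom_i (A B M : T.Algebra) :
    W.p _ M ≫ (W.associator A B M).hom.f ≫ W.i A _ =
      W.i A B ▷ M.A ≫ (α_ _ _ _).hom ≫ A.A ◁ W.p B M :=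
  letI := W.monoidal
  W.frobenius.frobenius_right A B M

instance (A B : T.Algebra) : IsSplitEpi (W.p A B) := ⟨⟨⟨W.i A B, W.i_p A B⟩⟩⟩

instance (A B : T.Algebra) (Z : C) : IsSplitEpi (W.p A B ▷ Z) :=
  ⟨⟨⟨W.i A B ▷ Z, by simp [← comp_whiskerRight]⟩⟩⟩

lemma tau_eq (X Y : C) : W.tau X Y = T.map (T.unit X ⊗ₘ T.unit Y) ≫
    T.map (W.p (T.freeAlgebra X) (T.freeAlgebra Y)) ≫
    (W.tensor (T.freeAlgebra X) (T.freeAlgebra Y)).a ≫ W.i _ _ := rfl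

lemma tau₀_eq : W.tau₀ = T.map W.p₀ ≫ W.unit.a ≫ W.i₀ := rfl

/-- The algebra morphism from the free algebra on `𝟙_ C` to the unit algebra which corresponds to
`p₀`. -/
@[simps]
def proj : T.freeAlgebra (𝟙_ C) ⟶ W.unit where
  f := T.map W.p₀ ≫ W.unit.a
  h := by
    change T.map (T.map W.p₀ ≫ W.unit.a) ≫ W.unit.a = T.mul (𝟙_ C) ≫ T.map W.p₀ ≫ W.unit.a
    rw [T.map_comp_assoc, map_a_a, reassoc_of% map_map_mul]

/-- A section of `proj`. -/
def sect : W.unit.A ⟶ T.obj (𝟙_ C) :=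
  (ρ_ _).inv ≫ W.unit.A ◁ T.unit (𝟙_ C) ≫ W.p W.unit (T.freeAlgebra (𝟙_ C)) ≫
    (W.leftUnitor (T.freeAlgebra (𝟙_ C))).hom.f

lemma unit_proj : T.unit (𝟙_ C) ≫ W.proj.f = W.p₀ := by
  rw [proj_f, ← reassoc_of% T.comp_unit, unit_a, Category.comp_id]

/-- Naturality of the left unitor moves `proj` inside, where the unit of `T` becomes `p₀`. The two
unitors agree on the unit algebra, so right unitality of `p` applies. -/
lemma sect_proj : W.sect ≫ W.proj.f = 𝟙 _ := by
  rw [sect, Category.assoc, Category.assoc, Category.assoc, ← W.leftUnitor_naturality,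
    ← reassoc_of% W.whiskerLeft_p, ← whiskerLeft_comp_assoc, unit_proj, leftUnitor_unit,
    p_rightUnitor, Iso.inv_hom_id]

variable [inst : T.toFunctor.OplaxMonoidal] (hW : W.opmonoidal = inst)
include hW

lemma δ_eq (X Y : C) : Functor.OplaxMonoidal.δ T.toFunctor X Y = W.tau X Y := by
  subst hW
  rfl

lemma η_eq : Functor.OplaxMonoidal.η T.toFunctor = W.proj.f ≫ W.i₀ := by
  subst hW
  exact W.tau₀_eq.trans (Category.assoc _ _ _).symm

/-- An action is a morphism from a free algebra, so `p` and `i` are natural along it. This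
transports the formula for `τ` from free algebras to arbitrary ones, and shows that `τ` determines
the idempotent and the action that the tensor product must split. -/
lemma act_eq (A B : T.Algebra) : act A B = T.map (W.p A B) ≫ (W.tensor A B).a ≫ W.i A B := by
  have e₁ : W.i (T.freeAlgebra A.A) (T.freeAlgebra B.A) ≫ (A.a ⊗ₘ B.a) =
      (W.whiskerRight (actionHom A) _).f ≫ (W.whiskerLeft _ (actionHom B)).f ≫ W.i A B := by
    rw [MonoidalCategory.tensorHom_def, ← W.i_whiskerLeft, ← reassoc_of% W.i_whiskerRight]
  have e₂ : W.p (T.freeAlgebra A.A) (T.freeAlgebra B.A) ≫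
      (W.whiskerRight (actionHom A) _).f ≫ (W.whiskerLeft _ (actionHom B)).f =
      (A.a ⊗ₘ B.a) ≫ W.p A B := by
    rw [MonoidalCategory.tensorHom_def, Category.assoc,
      show A.A ◁ B.a ≫ W.p A B = _ from W.whiskerLeft_p A (actionHom B),
      ← reassoc_of% W.whiskerRight_p]
  rw [act, W.δ_eq hW, tau_eq]
  simp only [Category.assoc]
  rw [e₁, ← reassoc_of% map_f_a, ← reassoc_of% map_f_a, ← T.map_comp_assoc, ← T.map_comp_assoc,
    ← T.map_comp_assoc, Category.assoc, Category.assoc, e₂, tensorHom_comp_tensorHom_assoc,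
    unit_a, unit_a, id_tensorHom_id, Category.id_comp]

lemma p_i (A B : T.Algebra) : W.p A B ≫ W.i A B = T.unit _ ≫ act A B := by
  rw [W.act_eq hW, ← reassoc_of% T.comp_unit, unit_a_assoc]

lemma map_p_a (A B : T.Algebra) :
    T.map (W.p A B) ≫ (W.tensor A B).a = act A B ≫ W.p A B := by
  rw [reassoc_of% W.act_eq hW, i_p, Category.comp_id]

lemma act_whiskerRight (A B M : T.Algebra) :
    actL A B M = T.map (W.p A B ▷ M.A) ≫ act (W.tensor A B) M ≫ W.i A B ▷ M.A := by
  rw [actL, W.act_eq hW, act, Category.assoc, ← Functor.OplaxMonoidal.δ_natural_left_assoc]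
  simp only [← tensorHom_id, tensorHom_comp_tensorHom, Category.id_comp, Category.comp_id]

lemma act_whiskerLeft (A B M : T.Algebra) :
    actR A B M = T.map (A.A ◁ W.p B M) ≫ act A (W.tensor B M) ≫ A.A ◁ W.i B M := by
  rw [actR, W.act_eq hW, act, Category.assoc, ← Functor.OplaxMonoidal.δ_natural_right_assoc]
  simp only [← id_tensorHom, tensorHom_comp_tensorHom, Category.id_comp, Category.comp_id]

lemma map_act_act (A B : T.Algebra) : T.map (act A B) ≫ act A B = T.mul _ ≫ act A B := by
  rw [W.act_eq hW, ← reassoc_of% T.map_map_mul, ← reassoc_of% map_a_a, ← T.map_comp_assoc,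
    Category.assoc, Category.assoc, i_p, Category.comp_id, T.map_comp_assoc]

lemma mul_δ (X Y : C) : T.mul (X ⊗ Y) ≫ Functor.OplaxMonoidal.δ T.toFunctor X Y =
    T.map (Functor.OplaxMonoidal.δ T.toFunctor X Y) ≫ Functor.OplaxMonoidal.δ T.toFunctor _ _ ≫
      (T.mul X ⊗ₘ T.mul Y) := by
  have e : Functor.OplaxMonoidal.δ T.toFunctor X Y =
      T.map (T.unit X ⊗ₘ T.unit Y) ≫ act (T.freeAlgebra X) (T.freeAlgebra Y) := by
    rw [act, ← Functor.OplaxMonoidal.δ_natural_assoc, tensorHom_comp_tensorHom, map_unit_mul,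
      map_unit_mul, id_tensorHom_id, Category.comp_id]
  change _ = _ ≫ act (T.freeAlgebra X) (T.freeAlgebra Y)
  rw [e, T.map_comp_assoc, W.map_act_act hW, reassoc_of% map_map_mul]

/-- By `act_eq` the contraction passes through the tensor product with the unit algebra, and
applying `i₀` there is the left unitor, a morphism of algebras. -/
lemma contractL_a (A : T.Algebra) :
    T.contractL A.A ≫ A.a =
      T.map (W.proj.f ▷ A.A ≫ W.p _ A ≫ (W.leftUnitor A).hom.f) ≫ A.a := by
  rw [← act_η_left, W.act_eq hW, W.η_eq hW, comp_whiskerRight]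
  simp only [Category.assoc]
  rw [reassoc_of% W.i_whiskerRight, i_leftUnitor, ← reassoc_of% map_f_a, ← map_f_a,
    ← T.map_comp_assoc, ← T.map_comp_assoc, Category.assoc, reassoc_of% W.whiskerRight_p]

lemma contractR_a (A : T.Algebra) :
    T.contractR A.A ≫ A.a =
      T.map (A.A ◁ W.proj.f ≫ W.p A _ ≫ (W.rightUnitor A).hom.f) ≫ A.a := by
  rw [← act_η_right, W.act_eq hW, W.η_eq hW, whiskerLeft_comp]
  simp only [Category.assoc]
  rw [reassoc_of% W.i_whiskerLeft, i_rightUnitor, ← reassoc_of% map_f_a, ← map_f_a,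
    ← T.map_comp_assoc, ← T.map_comp_assoc, Category.assoc, reassoc_of% W.whiskerLeft_p]

lemma contractL_eq (Y : C) :
    T.contractL Y = T.map (_ ◁ T.unit Y ≫ W.proj.f ▷ T.obj Y ≫ W.p _ (T.freeAlgebra Y) ≫
      (W.leftUnitor (T.freeAlgebra Y)).hom.f) ≫ T.mul Y := by
  have := W.contractL_a hW (T.freeAlgebra Y)
  rw [T.map_comp_assoc, ← this, ← reassoc_of% contractL_naturality, map_unit_mul, Category.comp_id]

lemma contractR_eq (X : C) :
    T.contractR X = T.map (T.unit X ▷ _ ≫ T.obj X ◁ W.proj.f ≫ W.p (T.freeAlgebra X) _ ≫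
      (W.rightUnitor (T.freeAlgebra X)).hom.f) ≫ T.mul X := by
  have := W.contractR_a hW (T.freeAlgebra X)
  rw [T.map_comp_assoc, ← this, ← reassoc_of% contractR_naturality, map_unit_mul, Category.comp_id]

lemma contractL₀_eq : T.contractL₀ = T.map (W.proj.f ≫ W.sect) ≫ T.mul (𝟙_ C) := by
  rw [contractL₀, W.contractL_eq hW, ← T.map_comp_assoc, sect, whisker_exchange_assoc]
  simp only [rightUnitor_inv_naturality_assoc]

/-- The section here is the mirror image of `sect`. The two are not shown to agree, nor need they
be: `map_contract_form` accepts any section of `proj`. -/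
lemma contractR₀_eq : ∃ s : W.unit.A ⟶ T.obj (𝟙_ C), s ≫ W.proj.f = 𝟙 _ ∧
    T.contractR₀ = T.map (W.proj.f ≫ s) ≫ T.mul (𝟙_ C) := by
  refine ⟨(λ_ _).inv ≫ T.unit (𝟙_ C) ▷ W.unit.A ≫ W.p (T.freeAlgebra (𝟙_ C)) W.unit ≫
    (W.rightUnitor (T.freeAlgebra (𝟙_ C))).hom.f, ?_, ?_⟩
  · rw [Category.assoc, Category.assoc, Category.assoc, ← W.rightUnitor_naturality,
      ← reassoc_of% W.whiskerRight_p, ← comp_whiskerRight_assoc, unit_proj, ← leftUnitor_unit,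
      p_leftUnitor, Iso.inv_hom_id]
  · rw [contractR₀, W.contractR_eq hW, ← T.map_comp_assoc, ← whisker_exchange_assoc]
    simp only [leftUnitor_inv_naturality_assoc]

lemma form_eq : T.form = T.map W.proj.f ≫ W.unit.a ≫ W.i₀ := by
  rw [form, W.η_eq hW, reassoc_of% map_f_a]

/-- `form` sees its argument only through `proj`, and `proj ≫ s ≫ proj = proj` for any section `s`.
-/
lemma map_contract_form (s : W.unit.A ⟶ T.obj (𝟙_ C)) (hs : s ≫ W.proj.f = 𝟙 _) :
    T.map (T.map (W.proj.f ≫ s) ≫ T.mul (𝟙_ C)) ≫ T.form = T.mul _ ≫ T.form := by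
  rw [T.map_comp_assoc, map_mul_form, reassoc_of% map_map_mul, W.form_eq hW, ← T.map_comp_assoc,
    Category.assoc, hs, Category.comp_id]

lemma isWeaklyBimonoidal : T.IsWeaklyBimonoidal where
  mul_δ := W.mul_δ hW
  form_contractL := by
    rw [W.contractL₀_eq hW, W.map_contract_form hW _ W.sect_proj]
  form_contractR := by
    obtain ⟨s, hs, e⟩ := W.contractR₀_eq hW
    rw [e, W.map_contract_form hW s hs]
  idem_left_right A B M := by
    rw [W.act_whiskerRight hW, Category.assoc, Category.assoc, ← reassoc_of% T.comp_unit,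
      ← reassoc_of% W.p_i hW, associator_i, reassoc_of% W.p_associator_hom_i, idem, idem,
      ← W.p_i hW, ← W.p_i hW]
    simp
  idem_right_left A B M := by
    have e : W.i A _ ≫ A.A ◁ W.i B M ≫ (α_ _ _ _).inv =
        (W.associator A B M).inv.f ≫ W.i _ M ≫ W.i A B ▷ M.A := by
      have e' : (W.associator A B M).inv.f ≫ (W.associator A B M).hom.f = 𝟙 _ :=
        congrArg Algebra.Hom.f (W.associator A B M).inv_hom_id
      rw [← cancel_mono (α_ _ _ _).hom]
      simp only [Category.assoc, Iso.inv_hom_id, Category.comp_id, associator_i]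
      rw [reassoc_of% e']
    rw [W.act_whiskerLeft hW, Category.assoc, Category.assoc, ← reassoc_of% T.comp_unit,
      ← reassoc_of% W.p_i hW, e, reassoc_of% W.p_associator_inv_i, idem, idem, ← W.p_i hW,
      ← W.p_i hW]
    simp

lemma unitIdem_eq : T.unitIdem = W.proj.f ≫ W.sect := by
  rw [unitIdem, W.contractL₀_eq hW, ← reassoc_of% T.comp_unit, unit_mul, Category.comp_id]

/-- The tensor product of a weak bimonad splits the idempotents associated with its opmonoidal
structure. -/
def pres (A B : T.Algebra) : Presentation (act A B) (W.tensor A B) where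
  p := W.p A B
  i := W.i A B
  i_p := W.i_p A B
  p_i := W.p_i hW A B
  map_p_a := W.map_p_a hW A B

/-- The unit of a weak bimonad splits the idempotent associated with its opmonoidal structure. -/
def unitPres : Presentation (T.mul (𝟙_ C) ≫ T.unitIdem) W.unit where
  p := W.proj.f
  i := W.sect
  i_p := W.sect_proj
  p_i := by rw [W.unitIdem_eq hW, unit_mul_assoc]
  map_p_a := by
    rw [W.unitIdem_eq hW, Category.assoc, Category.assoc, sect_proj, Category.comp_id, map_f_a]

end WeakBimonad

/-! ### Weak bimonads with the same opmonoidal structure are isomorphic. -/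

namespace WeakBimonad

open CategoryTheory.Monad

variable {C : Type u₁} [Category.{v₁} C] [MonoidalCategory C] {T : Monad C}

instance isIso_hom_f {A B : T.Algebra} (e : A ≅ B) : IsIso e.hom.f :=
  ⟨e.inv.f, congrArg Algebra.Hom.f e.hom_inv_id, congrArg Algebra.Hom.f e.inv_hom_id⟩

/-- The comparison morphisms are linear, so they move past the actions in `τ` and `τ₀`, where they
cancel against their inverses. -/
lemma opmonoidal_eq_of_iso {W W' : WeakBimonad T} (e : W.Iso W') :
    W.opmonoidal = W'.opmonoidal := by
  let φ (A B : T.Algebra) : W'.tensor A B ⟶ W.tensor A B := e.monoidal.μ A B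
  let ψ (A B : T.Algebra) : W.tensor A B ⟶ W'.tensor A B := e.monoidal.δ A B
  let φ₀ : W'.unit ⟶ W.unit := e.monoidal.ε
  let ψ₀ : W.unit ⟶ W'.unit := e.monoidal.η
  have h₁ (A B) : W'.p A B ≫ (φ A B).f = W.p A B := e.μ_comp A B
  have h₂ (A B) : (ψ A B).f ≫ W'.i A B = W.i A B := e.δ_comp A B
  have h₃ (A B) : (φ A B).f ≫ (ψ A B).f = 𝟙 _ := congrArg Algebra.Hom.f (e.monoidal.μ_δ A B)
  have k₁ : W'.p₀ ≫ φ₀.f = W.p₀ := e.ε_comp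
  have k₂ : ψ₀.f ≫ W'.i₀ = W.i₀ := e.η_comp
  have k₃ : φ₀.f ≫ ψ₀.f = 𝟙 _ := congrArg Algebra.Hom.f e.monoidal.ε_η
  refine Functor.OplaxMonoidal.ext ?_ ?_
  · change W.tau₀ = W'.tau₀
    rw [tau₀_eq, tau₀_eq, ← k₁, ← k₂, T.map_comp_assoc, reassoc_of% map_f_a, reassoc_of% k₃]
  · funext X Y
    change W.tau X Y = W'.tau X Y
    rw [tau_eq, tau_eq, ← h₁, ← h₂, T.map_comp_assoc, reassoc_of% map_f_a, reassoc_of% h₃]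

section

variable {W W' : WeakBimonad T} (h : W.opmonoidal = W'.opmonoidal)

/-- The comparison between the tensor products of two weak bimonads with the same opmonoidal
structure. -/
def compare (A B : T.Algebra) : W'.tensor A B ≅ W.tensor A B :=
  letI := W'.opmonoidal
  (W'.pres rfl A B).iso (W.pres h A B) (CategoryTheory.Iso.refl _)
    (by simp)

/-- The comparison between the units of two weak bimonads with the same opmonoidal structure. -/
def compareUnit : W'.unit ≅ W.unit :=
  letI := W'.opmonoidal
  (W'.unitPres rfl).iso (W.unitPres h) (CategoryTheory.Iso.refl _)
    (by simp)

lemma p_compare (A B : T.Algebra) : W'.p A B ≫ (compare h A B).hom.f = W.p A B := by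
  let := W'.opmonoidal
  have := (W'.pres rfl A B).p_hom (W.pres h A B) (𝟙 _) (by simp)
  exact this.trans (Category.id_comp _)

lemma compare_i (A B : T.Algebra) : (compare h A B).hom.f ≫ W.i A B = W'.i A B := by
  let := W'.opmonoidal
  have := (W'.pres rfl A B).hom_i (W.pres h A B) (𝟙 _) (by simp)
  exact this.trans (Category.comp_id _)

lemma p₀_compareUnit : W'.p₀ ≫ (compareUnit h).hom.f = W.p₀ := by
  let := W'.opmonoidal
  have := (W'.unitPres rfl).p_hom (W.unitPres h) (𝟙 _) (by simp)
  rw [← unit_proj, ← unit_proj, Category.assoc]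
  exact congrArg _ (this.trans (Category.id_comp _))

/-- Both counits become the same `η` after the projections from `T K`, and the comparison respects
the sections of those projections. -/
lemma compareUnit_i₀ : (compareUnit h).hom.f ≫ W.i₀ = W'.i₀ := by
  let inst := W'.opmonoidal
  have : (compareUnit h).hom.f ≫ W.sect = W'.sect :=
    ((W'.unitPres rfl).hom_i (W.unitPres h) (𝟙 _) (by simp)).trans (Category.comp_id _)
  have e : W.proj.f ≫ W.i₀ = W'.proj.f ≫ W'.i₀ := by
    rw [← W.η_eq h, ← W'.η_eq rfl]
  have := this =≫ (W.proj.f ≫ W.i₀)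
  rwa [Category.assoc, reassoc_of% sect_proj, e, reassoc_of% sect_proj] at this

lemma compare_naturality_left {A A' : T.Algebra} (f : A ⟶ A') (B : T.Algebra) :
    W'.whiskerRight f B ≫ (compare h A' B).hom = (compare h A B).hom ≫ W.whiskerRight f B := by
  ext
  rw [← cancel_epi (W'.p A B), Algebra.comp_f, Algebra.comp_f, ← reassoc_of% W'.whiskerRight_p,
    p_compare, reassoc_of% p_compare, W.whiskerRight_p]

lemma compare_naturality_right (A : T.Algebra) {B B' : T.Algebra} (g : B ⟶ B') :
    W'.whiskerLeft A g ≫ (compare h A B').hom = (compare h A B).hom ≫ W.whiskerLeft A g := by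
  ext
  rw [← cancel_epi (W'.p A B), Algebra.comp_f, Algebra.comp_f, ← reassoc_of% W'.whiskerLeft_p,
    p_compare, reassoc_of% p_compare, W.whiskerLeft_p]

lemma compare_associator (A B M : T.Algebra) :
    W'.whiskerRight (compare h A B).hom M ≫ (compare h _ M).hom ≫ (W.associator A B M).hom =
      (W'.associator A B M).hom ≫ W'.whiskerLeft A (compare h B M).hom ≫
        (compare h A _).hom := by
  ext
  rw [← cancel_epi (W'.p _ M), ← cancel_epi (W'.p A B ▷ M.A)]
  simp only [Algebra.comp_f]
  rw [← reassoc_of% W'.whiskerRight_p, ← comp_whiskerRight_assoc, p_compare, reassoc_of% p_compare,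
    W.p_associator, reassoc_of% W'.p_associator, ← reassoc_of% W'.whiskerLeft_p,
    ← whiskerLeft_comp_assoc, p_compare, p_compare]

lemma compare_leftUnitor (A : T.Algebra) :
    (W'.leftUnitor A).hom =
      W'.whiskerRight (compareUnit h).hom A ≫ (compare h _ A).hom ≫ (W.leftUnitor A).hom := by
  -- Followed by the invertible left unitor of algebras this is the left unitor of the base
  -- category, so it is invertible and may be cancelled.
  have : IsIso (W'.p₀ ▷ A.A ≫ W'.p _ A) := by
    have : IsIso ((W'.p₀ ▷ A.A ≫ W'.p _ A) ≫ (W'.leftUnitor A).hom.f) := by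
      rw [Category.assoc, p_leftUnitor]
      infer_instance
    exact IsIso.of_isIso_comp_right _ ((W'.leftUnitor A).hom.f)
  ext
  rw [← cancel_epi (W'.p₀ ▷ A.A ≫ W'.p _ A), Category.assoc, p_leftUnitor]
  simp only [Algebra.comp_f, Category.assoc]
  rw [← reassoc_of% W'.whiskerRight_p, ← comp_whiskerRight_assoc, p₀_compareUnit,
    reassoc_of% p_compare, p_leftUnitor]

lemma compare_rightUnitor (A : T.Algebra) :
    (W'.rightUnitor A).hom =
      W'.whiskerLeft A (compareUnit h).hom ≫ (compare h A _).hom ≫ (W.rightUnitor A).hom := by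
  have : IsIso (A.A ◁ W'.p₀ ≫ W'.p A _) := by
    have : IsIso ((A.A ◁ W'.p₀ ≫ W'.p A _) ≫ (W'.rightUnitor A).hom.f) := by
      rw [Category.assoc, p_rightUnitor]
      infer_instance
    exact IsIso.of_isIso_comp_right _ ((W'.rightUnitor A).hom.f)
  ext
  rw [← cancel_epi (A.A ◁ W'.p₀ ≫ W'.p A _), Category.assoc, p_rightUnitor]
  simp only [Algebra.comp_f, Category.assoc]
  rw [← reassoc_of% W'.whiskerLeft_p, ← whiskerLeft_comp_assoc, p₀_compareUnit,
    reassoc_of% p_compare, p_rightUnitor]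

/-- Two weak bimonads with the same opmonoidal structure are isomorphic. -/
def isoOfOpmonoidalEq : W.Iso W' where
  monoidal :=
    @Functor.CoreMonoidal.toMonoidal _ _ W.monoidal _ _ W'.monoidal (𝟭 T.Algebra)
      (@Functor.CoreMonoidal.mk _ _ W.monoidal _ _ W'.monoidal (𝟭 T.Algebra)
        (compareUnit h) (compare h) (compare_naturality_left h)
        (fun A g ↦ compare_naturality_right h A g) (compare_associator h)
        (compare_leftUnitor h) (compare_rightUnitor h))
  ε_comp := p₀_compareUnit h
  μ_comp := p_compare h
  η_comp := by
    have e : (compareUnit h).inv.f ≫ (compareUnit h).hom.f = 𝟙 _ :=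
      congrArg Algebra.Hom.f (compareUnit h).inv_hom_id
    change (compareUnit h).inv.f ≫ W'.i₀ = W.i₀
    rw [← compareUnit_i₀ h, reassoc_of% e]
  δ_comp A B := by
    have e : (compare h A B).inv.f ≫ (compare h A B).hom.f = 𝟙 _ :=
      congrArg Algebra.Hom.f (compare h A B).inv_hom_id
    change (compare h A B).inv.f ≫ W'.i A B = W.i A B
    rw [← compare_i h, reassoc_of% e]

end

lemma opmonoidal_eq_iff (W W' : WeakBimonad T) :
    W.opmonoidal = W'.opmonoidal ↔ Nonempty (W.Iso W') :=
  ⟨fun h ↦ ⟨isoOfOpmonoidalEq h⟩, fun ⟨e⟩ ↦ opmonoidal_eq_of_iso e⟩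

end WeakBimonad

/-! ### Opmonoidal structures on `• ⊗ B` built from a comultiplication and the braiding. -/

namespace CategoryTheory.BraidedCategory

variable {C : Type u₁} [Category.{v₁} C] [MonoidalCategory C] [BraidedCategory C]

section Tau

variable {B : C}

/-- The morphism `(X ⊗ Y) ⊗ B ⟶ (X ⊗ B) ⊗ (Y ⊗ B)` induced by `d : B ⟶ B ⊗ B` and the braiding. -/
def braidTau (d : B ⟶ B ⊗ B) (X Y : C) : (X ⊗ Y) ⊗ B ⟶ (X ⊗ B) ⊗ Y ⊗ B :=
  (X ⊗ Y) ◁ d ≫ tensorμ X Y B B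

lemma braidTau_unit (d : B ⟶ B ⊗ B) :
    (λ_ (𝟙_ C)).inv ▷ B ≫ braidTau d (𝟙_ C) (𝟙_ C) =
      (λ_ B).hom ≫ d ≫ ((λ_ B).inv ⊗ₘ (λ_ B).inv) := by
  have := tensor_left_unitality B B
  rw [braidTau, ← whisker_exchange_assoc, ← leftUnitor_naturality_assoc, this]
  simp

lemma braidTau_natural (d : B ⟶ B ⊗ B) {X X' Y Y' : C} (f : X ⟶ X') (g : Y ⟶ Y') :
    (f ⊗ₘ g) ▷ B ≫ braidTau d X' Y' = braidTau d X Y ≫ (f ▷ B ⊗ₘ g ▷ B) := by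
  rw [braidTau, braidTau, ← whisker_exchange_assoc, tensorμ_natural_left, Category.assoc]

lemma braidTau_associativity (d : B ⟶ B ⊗ B) (h : d ≫ B ◁ d = d ≫ d ▷ B ≫ (α_ B B B).hom)
    (X Y Z : C) :
    braidTau d (X ⊗ Y) Z ≫ braidTau d X Y ▷ (Z ⊗ B) ≫ (α_ _ _ _).hom =
      (α_ X Y Z).hom ▷ B ≫ braidTau d X (Y ⊗ Z) ≫ (X ⊗ B) ◁ braidTau d Y Z := by
  have e₁ := tensorμ_natural_right (X ⊗ Y) Z d (𝟙 B)
  have e₂ := tensorμ_natural_right X (Y ⊗ Z) (𝟙 B) d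
  simp only [tensorHom_id, id_tensorHom, whiskerLeft_id] at e₁ e₂
  have e₃ := associator_monoidal X Y Z B B B
  simp only [braidTau, comp_whiskerRight, whiskerLeft_comp, Category.assoc]
  rw [← reassoc_of% e₁, ← reassoc_of% e₂, e₃, ← whiskerLeft_comp_assoc _ d (B ◁ d), h,
    MonoidalCategory.tensorHom_def']
  simp only [whiskerLeft_comp, Category.assoc, whisker_exchange_assoc]

lemma braidTau_counit_left (d : B ⟶ B ⊗ B) (e : B ⟶ 𝟙_ C) (h : d ≫ e ▷ B = (λ_ B).inv) (X : C) :
    (λ_ X).inv ▷ B ≫ braidTau d (𝟙_ C) X ≫ ((λ_ B).hom ≫ e) ▷ (X ⊗ B) = (λ_ (X ⊗ B)).inv := by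
  have e₁ := leftUnitor_monoidal X B
  have e₂ := tensorμ_natural_right (𝟙_ C) X e (𝟙 B)
  simp only [tensorHom_id, whiskerLeft_id] at e₂
  rw [← cancel_mono (λ_ (X ⊗ B)).hom, Iso.inv_hom_id, braidTau, comp_whiskerRight]
  have e₃ : (λ_ B).hom ▷ (X ⊗ B) ≫ e ▷ (X ⊗ B) =
      (𝟙_ C ◁ e) ▷ (X ⊗ B) ≫ (λ_ (𝟙_ C)).hom ▷ (X ⊗ B) := by
    rw [← comp_whiskerRight, ← comp_whiskerRight, leftUnitor_naturality]
  simp only [Category.assoc]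
  rw [reassoc_of% e₃, ← reassoc_of% e₂, ← e₁, ← whiskerLeft_comp_assoc, h, ← whisker_exchange_assoc]
  monoidal

lemma braidTau_counit_right (d : B ⟶ B ⊗ B) (e : B ⟶ 𝟙_ C) (h : d ≫ B ◁ e = (ρ_ B).inv) (X : C) :
    (ρ_ X).inv ▷ B ≫ braidTau d X (𝟙_ C) ≫ (X ⊗ B) ◁ ((λ_ B).hom ≫ e) = (ρ_ (X ⊗ B)).inv := by
  have e₁ := rightUnitor_monoidal X B
  have e₂ := tensorμ_natural_right X (𝟙_ C) (𝟙 B) e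
  simp only [id_tensorHom, whiskerLeft_id] at e₂
  rw [← cancel_mono (ρ_ (X ⊗ B)).hom, Iso.inv_hom_id, braidTau]
  have e₃ : (X ⊗ B) ◁ ((λ_ B).hom ≫ e) =
      (X ⊗ B) ◁ (𝟙_ C ◁ e) ≫ (X ⊗ B) ◁ (λ_ (𝟙_ C)).hom := by
    rw [← whiskerLeft_comp, leftUnitor_naturality]
  simp only [Category.assoc]
  rw [e₃, Category.assoc, ← reassoc_of% e₂, ← e₁, ← whiskerLeft_comp_assoc, h,
    ← whisker_exchange_assoc]
  monoidal

/-- The compatibility of `braidTau` with multiplication, for a not necessarily associative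
multiplication. -/
lemma braidTau_mul (d : B ⟶ B ⊗ B) (m : B ⊗ B ⟶ B) (X Y : C) :
    braidTau d X Y ▷ B ≫ braidTau d (X ⊗ B) (Y ⊗ B) ≫
        ((α_ X B B).hom ≫ X ◁ m ⊗ₘ (α_ Y B B).hom ≫ Y ◁ m) =
      (α_ _ _ _).hom ≫ (X ⊗ Y) ◁ ((d ⊗ₘ d) ≫ tensorμ B B B B ≫ (m ⊗ₘ m)) ≫
        tensorμ X Y B B := by
  have e₁ := tensor_associativity X Y B B B B
  have e₂ := tensorμ_natural_right X Y m m
  simp only [whiskerLeft_comp, Category.assoc]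
  rw [e₂, ← tensorHom_comp_tensorHom, braidTau, braidTau]
  simp only [comp_whiskerRight, Category.assoc]
  rw [← whisker_exchange_assoc, reassoc_of% e₁, MonoidalCategory.tensorHom_def d]
  simp

end Tau

end CategoryTheory.BraidedCategory

/-! ### Recovering the comonoid by evaluation at the unit object. -/

namespace CategoryTheory.BraidedCategory

variable {C : Type u₁} [Category.{v₁} C] [MonoidalCategory C] [BraidedCategory C]
  {B : C}

lemma comul_assoc_of_braidTau (d : B ⟶ B ⊗ B)
    (h : braidTau d (𝟙_ C ⊗ 𝟙_ C) (𝟙_ C) ≫ braidTau d (𝟙_ C) (𝟙_ C) ▷ (𝟙_ C ⊗ B) ≫ (α_ _ _ _).hom =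
      (α_ (𝟙_ C) (𝟙_ C) (𝟙_ C)).hom ▷ B ≫ braidTau d (𝟙_ C) (𝟙_ C ⊗ 𝟙_ C) ≫
        (𝟙_ C ⊗ B) ◁ braidTau d (𝟙_ C) (𝟙_ C)) :
    d ≫ B ◁ d = d ≫ d ▷ B ≫ (α_ B B B).hom := by
  have n₁ := braidTau_natural d (λ_ (𝟙_ C)).inv (𝟙 (𝟙_ C))
  have n₂ := braidTau_natural d (𝟙 (𝟙_ C)) (λ_ (𝟙_ C)).inv
  simp only [tensorHom_id, id_tensorHom, id_whiskerRight] at n₁ n₂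
  have c : (λ_ (𝟙_ C)).inv ▷ B ≫ (λ_ (𝟙_ C)).inv ▷ 𝟙_ C ▷ B ≫
      (α_ (𝟙_ C) (𝟙_ C) (𝟙_ C)).hom ▷ B = (λ_ (𝟙_ C)).inv ▷ B ≫ (𝟙_ C ◁ (λ_ (𝟙_ C)).inv) ▷ B := by
    monoidal
  have u := braidTau_unit d
  have e := ((λ_ (𝟙_ C)).inv ▷ B ≫ (λ_ (𝟙_ C)).inv ▷ 𝟙_ C ▷ B) ≫= h
  simp only [Category.assoc] at e
  rw [reassoc_of% n₁, reassoc_of% c, reassoc_of% n₂, reassoc_of% u, reassoc_of% u,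
    ← comp_whiskerRight_assoc, ← whiskerLeft_comp, u, cancel_epi] at e
  have l : ((λ_ B).inv ⊗ₘ (λ_ B).inv) ≫
      ((λ_ B).hom ≫ d ≫ ((λ_ B).inv ⊗ₘ (λ_ B).inv)) ▷ (𝟙_ C ⊗ B) ≫ (α_ _ _ _).hom =
      d ▷ B ≫ (α_ _ _ _).hom ≫ ((λ_ B).inv ⊗ₘ (λ_ B).inv ⊗ₘ (λ_ B).inv) := by
    rw [← associator_naturality, ← tensorHom_id, tensorHom_comp_tensorHom_assoc, ← tensorHom_id,
      tensorHom_comp_tensorHom_assoc]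
    simp
  have r : ((λ_ B).inv ⊗ₘ (λ_ B).inv) ≫
      (𝟙_ C ⊗ B) ◁ ((λ_ B).hom ≫ d ≫ ((λ_ B).inv ⊗ₘ (λ_ B).inv)) =
      B ◁ d ≫ ((λ_ B).inv ⊗ₘ (λ_ B).inv ⊗ₘ (λ_ B).inv) := by
    rw [← id_tensorHom, tensorHom_comp_tensorHom, ← id_tensorHom, tensorHom_comp_tensorHom]
    simp
  rw [l, r, ← Category.assoc, ← Category.assoc, ← Category.assoc, cancel_mono, Category.assoc] at e
  exact e.symm

lemma counit_comul_of_braidTau (d : B ⟶ B ⊗ B) (e : B ⟶ 𝟙_ C)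
    (h : (λ_ (𝟙_ C)).inv ▷ B ≫ braidTau d (𝟙_ C) (𝟙_ C) ≫ ((λ_ B).hom ≫ e) ▷ (𝟙_ C ⊗ B) =
      (λ_ (𝟙_ C ⊗ B)).inv) :
    d ≫ e ▷ B = (λ_ B).inv := by
  rw [reassoc_of% braidTau_unit d, ← tensorHom_id, tensorHom_comp_tensorHom,
    Iso.inv_hom_id_assoc, Category.comp_id, ← Iso.eq_inv_comp,
    MonoidalCategory.tensorHom_def e, ← Category.assoc] at h
  rw [← cancel_mono (𝟙_ C ◁ (λ_ B).inv), h]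
  simp

lemma comul_counit_of_braidTau (d : B ⟶ B ⊗ B) (e : B ⟶ 𝟙_ C)
    (h : (ρ_ (𝟙_ C)).inv ▷ B ≫ braidTau d (𝟙_ C) (𝟙_ C) ≫ (𝟙_ C ⊗ B) ◁ ((λ_ B).hom ≫ e) =
      (ρ_ (𝟙_ C ⊗ B)).inv) :
    d ≫ B ◁ e = (ρ_ B).inv := by
  rw [← unitors_inv_equal, reassoc_of% braidTau_unit d, ← id_tensorHom, tensorHom_comp_tensorHom,
    Iso.inv_hom_id_assoc, Category.comp_id, ← Iso.eq_inv_comp, tensorHom_def',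
    ← Category.assoc] at h
  rw [← cancel_mono ((λ_ B).inv ▷ 𝟙_ C), h]
  simp

variable [MonObj B]

/-- The opmonoidal structure on `• ⊗ B` induced by a comonoid structure on `B` and the braiding. -/
@[reducible]
def oplaxOfComon (b : ComonObj B) : (tensorMonad B).toFunctor.OplaxMonoidal where
  η := (λ_ B).hom ≫ b.counit
  δ X Y := braidTau b.comul X Y
  δ_natural_left {X Y} f X' := by
    have := braidTau_natural b.comul f (𝟙 X')
    simp only [id_whiskerRight, tensorHom_id] at this
    exact this.symm
  δ_natural_right {X Y} X' f := by
    have := braidTau_natural b.comul (𝟙 X') f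
    simp only [id_whiskerRight, id_tensorHom] at this
    exact this.symm
  oplax_associativity X Y Z := braidTau_associativity b.comul (by simp) X Y Z
  oplax_left_unitality X :=
    (braidTau_counit_left b.comul b.counit (by simp) X).symm
  oplax_right_unitality X :=
    (braidTau_counit_right b.comul b.counit (by simp) X).symm

lemma comulOf_oplaxOfComon (b : ComonObj B) : comulOf B (oplaxOfComon b) = b.comul := by
  have : (λ_ B).inv ≫ (λ_ (𝟙_ C)).inv ▷ B ≫ braidTau b.comul (𝟙_ C) (𝟙_ C) ≫
      ((λ_ B).hom ⊗ₘ (λ_ B).hom) = b.comul := by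
    rw [reassoc_of% braidTau_unit]
    simp
  exact this

lemma counitOf_oplaxOfComon (b : ComonObj B) : counitOf B (oplaxOfComon b) = b.counit :=
  Iso.inv_hom_id_assoc (λ_ B) b.counit

lemma factorsThroughBraiding_oplaxOfComon (b : ComonObj B) :
    FactorsThroughBraiding B (oplaxOfComon b) := fun X Y ↦ by
  rw [comulOf_oplaxOfComon]
  rfl

omit [BraidedCategory C] in
lemma counitOf_eq (τ : (tensorMonad B).toFunctor.OplaxMonoidal) : τ.η = (λ_ B).hom ≫ counitOf B τ :=
  (Iso.hom_inv_id_assoc (λ_ B) τ.η).symm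

/-- The comonoid structure on `B` induced by an opmonoidal structure on `• ⊗ B` which factors
through the braiding. -/
@[reducible]
def comonOfOplax (τ : (tensorMonad B).toFunctor.OplaxMonoidal) (h : FactorsThroughBraiding B τ) :
    ComonObj B where
  counit := counitOf B τ
  comul := comulOf B τ
  counit_comul := by
    apply counit_comul_of_braidTau
    have e := τ.oplax_left_unitality (𝟙_ C)
    rw [h, counitOf_eq] at e
    exact e.symm
  comul_counit := by
    apply comul_counit_of_braidTau
    have e := τ.oplax_right_unitality (𝟙_ C)
    rw [h, counitOf_eq] at e
    exact e.symm
  comul_assoc := by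
    apply comul_assoc_of_braidTau
    have e := τ.oplax_associativity (𝟙_ C) (𝟙_ C) (𝟙_ C)
    rw [h, h, h] at e
    exact e

lemma oplaxOfComon_comonOfOplax (τ : (tensorMonad B).toFunctor.OplaxMonoidal)
    (h : FactorsThroughBraiding B τ) : oplaxOfComon (comonOfOplax τ h) = τ :=
  Functor.OplaxMonoidal.ext (counitOf_eq τ).symm (funext₂ fun X Y ↦ (h X Y).symm)

end CategoryTheory.BraidedCategory

/-! ### Multiplicativity and the counit axioms. -/

namespace CategoryTheory.BraidedCategory

variable {C : Type u₁} [Category.{v₁} C] [MonoidalCategory C] [BraidedCategory C] {B : C}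

lemma mul_braidTau (d : B ⟶ B ⊗ B) (m : B ⊗ B ⟶ B)
    (h : m ≫ d = (d ⊗ₘ d) ≫ tensorμ B B B B ≫ (m ⊗ₘ m)) (X Y : C) :
    ((α_ _ _ _).hom ≫ (X ⊗ Y) ◁ m) ≫ braidTau d X Y =
      braidTau d X Y ▷ B ≫ braidTau d (X ⊗ B) (Y ⊗ B) ≫
        ((α_ X B B).hom ≫ X ◁ m ⊗ₘ (α_ Y B B).hom ≫ Y ◁ m) := by
  rw [braidTau_mul, ← h, whiskerLeft_comp, Category.assoc, Category.assoc, braidTau]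

lemma mul_comul_of_braidTau (d : B ⟶ B ⊗ B) (m : B ⊗ B ⟶ B)
    (h : ((α_ _ _ _).hom ≫ (𝟙_ C ⊗ 𝟙_ C) ◁ m) ≫ braidTau d (𝟙_ C) (𝟙_ C) =
      braidTau d (𝟙_ C) (𝟙_ C) ▷ B ≫ braidTau d (𝟙_ C ⊗ B) (𝟙_ C ⊗ B) ≫
        ((α_ (𝟙_ C) B B).hom ≫ 𝟙_ C ◁ m ⊗ₘ (α_ (𝟙_ C) B B).hom ≫ 𝟙_ C ◁ m)) :
    m ≫ d = (d ⊗ₘ d) ≫ tensorμ B B B B ≫ (m ⊗ₘ m) := by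
  rw [braidTau_mul, braidTau, Category.assoc, cancel_epi, ← whiskerLeft_comp_assoc] at h
  -- The middle interchange is invertible with inverse `tensorδ`, so it can be cancelled to leave
  -- the axiom tensored with unit objects.
  have e := h =≫ tensorδ (𝟙_ C) (𝟙_ C) B B
  simp only [Category.assoc, tensorμ_tensorδ, Category.comp_id] at e
  have e' := (λ_ (𝟙_ C)).inv ▷ _ ≫= e
  rw [← whisker_exchange, ← whisker_exchange, cancel_mono] at e'
  simpa using e' =≫ (λ_ (B ⊗ B)).hom

lemma rightUnitor_inv_braidTau (d : B ⟶ B ⊗ B) (X : C) :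
    (ρ_ X).inv ▷ B ≫ braidTau d X (𝟙_ C) = X ◁ d ≫ (α_ _ _ _).inv ≫ (X ⊗ B) ◁ (λ_ B).inv := by
  rw [braidTau, ← whisker_exchange_assoc]
  simp only [tensorμ, braiding_tensorUnit_left]
  monoidal

lemma leftUnitor_inv_braidTau (d : B ⟶ B ⊗ B) (X : C) :
    (λ_ X).inv ▷ B ≫ braidTau d (𝟙_ C) X = X ◁ d ≫ (α_ _ _ _).inv ≫ (β_ X B).hom ▷ B ≫
      (α_ _ _ _).hom ≫ (λ_ B).inv ▷ (X ⊗ B) := by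
  rw [braidTau, ← whisker_exchange_assoc]
  simp [tensorμ]

/-- A strand slides past the scalar-valued `a` by naturality of the braiding. One crossing on one
side becomes an inverse crossing on the other, which is the origin of `c⁻¹` in the counit axiom. -/
lemma braiding_contract {B X : C} (a : B ⊗ B ⟶ 𝟙_ C) :
    (β_ B X).hom ▷ B ≫ (α_ _ _ _).hom ≫ X ◁ a ≫ (ρ_ X).hom =
      (α_ _ _ _).hom ≫ B ◁ (β_ B X).inv ≫ (α_ _ _ _).inv ≫ a ▷ X ≫ (λ_ X).hom := by
  have h : a ▷ X ≫ (λ_ X).hom = (β_ (B ⊗ B) X).hom ≫ X ◁ a ≫ (ρ_ X).hom := by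
    rw [← braiding_naturality_left_assoc]
    simp
  rw [h]
  simp

/-- Contraction of the left leg of `d` with `a`. -/
def contractLeft (d : B ⟶ B ⊗ B) (a : B ⊗ B ⟶ 𝟙_ C) : B ⊗ B ⟶ B :=
  B ◁ d ≫ (α_ _ _ _).inv ≫ a ▷ B ≫ (λ_ B).hom

/-- Contraction of the right leg of `d` with `a`, by way of the braiding. -/
def contractRight (d : B ⟶ B ⊗ B) (a : B ⊗ B ⟶ 𝟙_ C) : B ⊗ B ⟶ B :=
  B ◁ d ≫ (α_ _ _ _).inv ≫ (β_ B B).hom ▷ B ≫ (α_ _ _ _).hom ≫ B ◁ a ≫ (ρ_ B).hom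

omit [BraidedCategory C] in
lemma contractLeft_comp (d : B ⟶ B ⊗ B) (m : B ⊗ B ⟶ B) (e : B ⟶ 𝟙_ C) :
    contractLeft d (m ≫ e) ▷ B ≫ m ≫ e =
      (B ◁ d) ▷ B ⊗≫ (m ⊗ₘ m) ≫ (e ⊗ₘ e) ≫ (λ_ (𝟙_ C)).hom := by
  rw [tensorHom_comp_tensorHom_assoc]
  generalize m ≫ e = a
  rw [contractLeft, MonoidalCategory.tensorHom_def]
  monoidal

lemma contractRight_comp (d : B ⟶ B ⊗ B) (m : B ⊗ B ⟶ B) (e : B ⟶ 𝟙_ C) :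
    contractRight d (m ≫ e) ▷ B ≫ m ≫ e =
      (B ◁ d) ▷ B ⊗≫ tensorδ B B B B ≫ (m ⊗ₘ m) ≫ (e ⊗ₘ e) ≫ (λ_ (𝟙_ C)).hom := by
  rw [tensorHom_comp_tensorHom_assoc]
  generalize m ≫ e = a
  rw [contractRight, braiding_contract, tensorδ, MonoidalCategory.tensorHom_def]
  monoidal

/-- `contractLeft`, in the form in which it arises from the monad `• ⊗ B`. -/
lemma contractLeft_eq (d : B ⟶ B ⊗ B) (a : B ⊗ B ⟶ 𝟙_ C) :
    (ρ_ (𝟙_ C ⊗ B)).inv ▷ B ≫ braidTau d (𝟙_ C ⊗ B) (𝟙_ C) ≫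
        ((λ_ B).hom ▷ B ≫ a) ▷ (𝟙_ C ⊗ B) ≫ (λ_ _).hom =
      (λ_ B).hom ▷ B ≫ contractLeft d a ≫ (λ_ B).inv := by
  have n := braidTau_natural d (λ_ B).hom (𝟙 (𝟙_ C))
  simp only [tensorHom_id, id_whiskerRight] at n
  rw [comp_whiskerRight_assoc, ← reassoc_of% n, ← comp_whiskerRight_assoc,
    ← rightUnitor_inv_naturality, comp_whiskerRight_assoc, reassoc_of% rightUnitor_inv_braidTau,
    contractLeft]
  monoidal

/-- `contractRight`, in the form in which it arises from the monad `• ⊗ B`. -/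
lemma contractRight_eq (d : B ⟶ B ⊗ B) (a : B ⊗ B ⟶ 𝟙_ C) :
    (λ_ (𝟙_ C ⊗ B)).inv ▷ B ≫ braidTau d (𝟙_ C) (𝟙_ C ⊗ B) ≫
        (𝟙_ C ⊗ B) ◁ ((λ_ B).hom ▷ B ≫ a) ≫ (ρ_ _).hom =
      (λ_ B).hom ▷ B ≫ contractRight d a ≫ (λ_ B).inv := by
  have n := braidTau_natural d (𝟙 (𝟙_ C)) (λ_ B).hom
  simp only [id_tensorHom, id_whiskerRight] at n
  rw [whiskerLeft_comp_assoc, ← reassoc_of% n, ← comp_whiskerRight_assoc,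
    ← leftUnitor_inv_naturality, comp_whiskerRight_assoc, reassoc_of% leftUnitor_inv_braidTau,
    contractRight]
  monoidal

end CategoryTheory.BraidedCategory

/-! ### Endomorphisms given by points of a monoid. -/

namespace CategoryTheory.BraidedCategory

variable {C : Type u₁} [Category.{v₁} C] [MonoidalCategory C]

/-- The endomorphism of `X` given by a point of `M` and `x : X ⊗ M ⟶ X`. -/
def pointAct {X M : C} (x : X ⊗ M ⟶ X) (n : 𝟙_ C ⟶ M) : X ⟶ X := (ρ_ X).inv ≫ X ◁ n ≫ x

/-- The product of two points of a monoid. -/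
def pointMul {M : C} [MonObj M] (n n' : 𝟙_ C ⟶ M) : 𝟙_ C ⟶ M :=
  (λ_ (𝟙_ C)).inv ≫ (n ⊗ₘ n') ≫ MonObj.mul

/-- The associativity of a right action of a monoid. -/
def IsAssocAction {X M : C} [MonObj M] (x : X ⊗ M ⟶ X) : Prop :=
  x ▷ M ≫ x = (α_ _ _ _).hom ≫ X ◁ MonObj.mul ≫ x

lemma IsAssocAction.pointAct_comp {X M : C} [MonObj M] {x : X ⊗ M ⟶ X} (h : IsAssocAction x)
    (n n' : 𝟙_ C ⟶ M) : pointAct x n ≫ pointAct x n' = pointAct x (pointMul n n') := by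
  have e : X ◁ (n ⊗ₘ n') = X ◁ n ▷ 𝟙_ C ≫ X ◁ M ◁ n' := by
    rw [MonoidalCategory.tensorHom_def, whiskerLeft_comp]
  have e' : (ρ_ X).inv ≫ X ◁ n ≫ x ≫ (ρ_ X).inv ≫ X ◁ n' ≫ x =
      ((ρ_ X).inv ≫ X ◁ n ≫ (ρ_ _).inv ≫ (X ⊗ M) ◁ n') ≫ x ▷ M ≫ x := by
    rw [rightUnitor_inv_naturality_assoc x, ← whisker_exchange_assoc]
    simp only [Category.assoc]
  simp only [pointAct, pointMul, Category.assoc, whiskerLeft_comp]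
  rw [e', h, e]
  monoidal

lemma one_comp_pointAct_mul {M : C} [MonObj M] (n : 𝟙_ C ⟶ M) :
    MonObj.one ≫ pointAct MonObj.mul n = n := by
  rw [pointAct, rightUnitor_inv_naturality_assoc, ← whisker_exchange_assoc, MonObj.one_mul]
  simp [← unitors_inv_equal]

variable [BraidedCategory C]

/-- The action of `M ⊗ N` on `X ⊗ Y` induced by an action of `M` on `X` and one of `N` on `Y`. -/
def tensorAct {X Y M N : C} (x : X ⊗ M ⟶ X) (y : Y ⊗ N ⟶ Y) : (X ⊗ Y) ⊗ M ⊗ N ⟶ X ⊗ Y :=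
  tensorμ X Y M N ≫ (x ⊗ₘ y)

lemma IsAssocAction.tensorAct {X Y M N : C} [MonObj M] [MonObj N] {x : X ⊗ M ⟶ X}
    {y : Y ⊗ N ⟶ Y} (hx : IsAssocAction x) (hy : IsAssocAction y) :
    IsAssocAction (tensorAct x y) := by
  have e₁ := tensor_associativity X Y M N M N
  have e₂ := tensorμ_natural_right X Y (MonObj.mul (X := M)) (MonObj.mul (X := N))
  have e₃ := tensorμ_natural_left x y M N
  unfold IsAssocAction at *
  simp only [BraidedCategory.tensorAct, comp_whiskerRight, Category.assoc]
  rw [reassoc_of% e₃, tensorHom_comp_tensorHom, hx, hy, ← tensorHom_comp_tensorHom,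
    reassoc_of% e₁, MonObj.tensorObj.mul_def]
  simp only [whiskerLeft_comp, Category.assoc]
  rw [reassoc_of% e₂, tensorHom_comp_tensorHom]

lemma pointAct_tensorAct {X Y M N : C} (x : X ⊗ M ⟶ X) (y : Y ⊗ N ⟶ Y) (n : 𝟙_ C ⟶ M)
    (n' : 𝟙_ C ⟶ N) :
    pointAct (tensorAct x y) ((λ_ (𝟙_ C)).inv ≫ (n ⊗ₘ n')) = pointAct x n ⊗ₘ pointAct y n' := by
  have e₁ := tensorμ_natural_right X Y n n'
  have e₂ := tensor_right_unitality X Y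
  have e₃ : (ρ_ (X ⊗ Y)).inv ≫ (X ⊗ Y) ◁ (λ_ (𝟙_ C)).inv ≫ tensorμ X Y (𝟙_ C) (𝟙_ C) =
      ((ρ_ X).inv ⊗ₘ (ρ_ Y).inv) := by
    rw [← cancel_mono ((ρ_ X).hom ⊗ₘ (ρ_ Y).hom), Category.assoc, Category.assoc, ← e₂,
      Iso.inv_hom_id, tensorHom_comp_tensorHom, Iso.inv_hom_id, Iso.inv_hom_id, id_tensorHom_id]
  simp only [pointAct, tensorAct, whiskerLeft_comp, Category.assoc]
  rw [reassoc_of% e₁, reassoc_of% e₃, tensorHom_comp_tensorHom, tensorHom_comp_tensorHom]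

lemma tensorAct_associator {X Y Z M N P : C} (x : X ⊗ M ⟶ X) (y : Y ⊗ N ⟶ Y) (z : Z ⊗ P ⟶ Z) :
    tensorAct (tensorAct x y) z ≫ (α_ X Y Z).hom =
      ((α_ X Y Z).hom ⊗ₘ (α_ M N P).hom) ≫ tensorAct x (tensorAct y z) := by
  have e := associator_monoidal X Y Z M N P
  have h₁ : tensorAct x y ⊗ₘ z = tensorμ X Y M N ▷ (Z ⊗ P) ≫ ((x ⊗ₘ y) ⊗ₘ z) := by
    rw [tensorAct, ← tensorHom_id, tensorHom_comp_tensorHom, Category.id_comp]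
  have h₂ : x ⊗ₘ tensorAct y z = (X ⊗ M) ◁ tensorμ Y Z N P ≫ (x ⊗ₘ y ⊗ₘ z) := by
    rw [tensorAct, ← id_tensorHom, tensorHom_comp_tensorHom, Category.id_comp]
  rw [tensorAct, h₁, Category.assoc, Category.assoc, associator_naturality, reassoc_of% e,
    ← h₂]
  rfl

lemma pointAct_associator {X Y Z M N P : C} (x : X ⊗ M ⟶ X) (y : Y ⊗ N ⟶ Y) (z : Z ⊗ P ⟶ Z)
    (n : 𝟙_ C ⟶ M ⊗ N ⊗ P) :
    pointAct (tensorAct (tensorAct x y) z) (n ≫ (α_ M N P).inv) ≫ (α_ X Y Z).hom =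
      (α_ X Y Z).hom ≫ pointAct (tensorAct x (tensorAct y z)) n := by
  simp only [pointAct, Category.assoc]
  rw [tensorAct_associator, rightUnitor_inv_naturality_assoc, ← whisker_exchange_assoc,
    MonoidalCategory.tensorHom_def']
  simp

end CategoryTheory.BraidedCategory

/-! ### Products in tensor powers of `B` with units in some of the factors. -/

namespace CategoryTheory.BraidedCategory

variable {C : Type u₁} [Category.{v₁} C] [MonoidalCategory C]

section

/-- The inclusion of the left factor of the tensor product with a monoid. -/
def inclLeft (M N : C) [MonObj N] : M ⟶ M ⊗ N := (ρ_ M).inv ≫ M ◁ MonObj.one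

/-- The inclusion of the right factor of the tensor product with a monoid. -/
def inclRight (M N : C) [MonObj M] : N ⟶ M ⊗ N := (λ_ N).inv ≫ MonObj.one ▷ N

variable [BraidedCategory C] {L M N : C} [MonObj M] [MonObj N]

lemma whiskerLeft_inclRight_mul :
    (M ⊗ N) ◁ inclRight M N ≫ MonObj.mul = (α_ _ _ _).hom ≫ M ◁ MonObj.mul := by
  have n := tensorμ_natural_right M N (MonObj.one (X := M)) (𝟙 N)
  simp only [tensorHom_id, whiskerLeft_id] at n
  rw [inclRight, whiskerLeft_comp_assoc, MonObj.tensorObj.mul_def, reassoc_of% n, ← tensorHom_id,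
    tensorHom_comp_tensorHom, MonObj.mul_one, Category.id_comp,
    MonoidalCategory.tensorHom_def', tensorμ, braiding_tensorUnit_right]
  monoidal

lemma whiskerRight_inclRight_mul :
    inclRight M N ▷ (M ⊗ N) ≫ MonObj.mul =
      (α_ _ _ _).inv ≫ (β_ N M).hom ▷ N ≫ (α_ _ _ _).hom ≫ M ◁ MonObj.mul := by
  have n := tensorμ_natural_left (MonObj.one (X := M)) (𝟙 N) M N
  simp only [tensorHom_id, id_whiskerRight] at n
  rw [inclRight, comp_whiskerRight_assoc, MonObj.tensorObj.mul_def, reassoc_of% n,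
    ← tensorHom_id (MonObj.one ▷ M), tensorHom_comp_tensorHom, MonObj.one_mul, Category.id_comp,
    MonoidalCategory.tensorHom_def', tensorμ]
  monoidal

lemma inclLeft_tensorHom_mul (f : L ⟶ M) :
    (inclLeft M N ⊗ₘ f ▷ N) ≫ MonObj.mul = (α_ _ _ _).inv ≫ (M ◁ f ≫ MonObj.mul) ▷ N := by
  have n := tensorμ_natural (𝟙 M) (MonObj.one (X := N)) f (𝟙 N)
  simp only [tensorHom_id, id_tensorHom] at n
  have e : (inclLeft M N ⊗ₘ f ▷ N) = (ρ_ M).inv ▷ (L ⊗ N) ≫ (M ◁ MonObj.one ⊗ₘ f ▷ N) := by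
    rw [inclLeft, ← tensorHom_id _ (L ⊗ N), tensorHom_comp_tensorHom, Category.id_comp]
  rw [e, MonObj.tensorObj.mul_def, Category.assoc, reassoc_of% n, tensorHom_comp_tensorHom,
    MonObj.one_mul, MonoidalCategory.tensorHom_def', tensorμ, braiding_tensorUnit_left]
  monoidal

lemma tensorHom_inclLeft_mul (f : L ⟶ M) :
    (f ▷ N ⊗ₘ inclLeft M N) ≫ MonObj.mul =
      (α_ _ _ _).hom ≫ L ◁ (β_ N M).hom ≫ (α_ _ _ _).inv ≫ (f ▷ M ≫ MonObj.mul) ▷ N := by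
  have n := tensorμ_natural f (𝟙 N) (𝟙 M) (MonObj.one (X := N))
  simp only [tensorHom_id, id_tensorHom] at n
  have e : (f ▷ N ⊗ₘ inclLeft M N) = (L ⊗ N) ◁ (ρ_ M).inv ≫ (f ▷ N ⊗ₘ M ◁ MonObj.one) := by
    rw [inclLeft, ← id_tensorHom (L ⊗ N), tensorHom_comp_tensorHom, Category.id_comp]
  rw [e, MonObj.tensorObj.mul_def, Category.assoc, reassoc_of% n, tensorHom_comp_tensorHom,
    MonObj.mul_one, MonoidalCategory.tensorHom_def', tensorμ]
  monoidal

end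

variable [BraidedCategory C] (B : C) [MonObj B]

lemma inclLeft_tensor_inclRight_mul :
    (inclLeft (B ⊗ B) B ⊗ₘ inclRight B B ▷ B) ≫ MonObj.mul (X := (B ⊗ B) ⊗ B) =
      𝟙 _ ⊗≫ (B ◁ MonObj.mul (X := B)) ▷ B ⊗≫ 𝟙 _ := by
  rw [inclLeft_tensorHom_mul, whiskerLeft_inclRight_mul]
  monoidal

lemma inclRight_tensor_inclLeft_mul :
    (inclRight B B ▷ B ⊗ₘ inclLeft (B ⊗ B) B) ≫ MonObj.mul (X := (B ⊗ B) ⊗ B) =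
      (β_ (B ⊗ B) (B ⊗ B)).hom ≫ tensorδ B B B B ⊗≫
        (B ◁ MonObj.mul (X := B)) ▷ B ⊗≫ 𝟙 _ := by
  rw [tensorHom_inclLeft_mul, whiskerRight_inclRight_mul, braiding_tensor_left_hom]
  have h : (β_ B (B ⊗ B)).hom ▷ B = 𝟙 _ ⊗≫ (β_ B B).hom ▷ B ▷ B ⊗≫ B ◁ (β_ B B).hom ▷ B ⊗≫ 𝟙 _ := by
    rw [braiding_tensor_right_hom]
    monoidal
  rw [h, tensorδ]
  calc
    _ = 𝟙 _ ⊗≫ B ◁ (β_ B (B ⊗ B)).hom ⊗≫ (β_ B B).hom ▷ B ▷ B ⊗≫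
          (B ◁ MonObj.mul (X := B)) ▷ B ⊗≫ 𝟙 _ := by monoidal
    -- The product uses only three of the four crossings in the braiding of `B ⊗ B` with itself. The
    -- missing middle one is inserted with its inverse, and that inverse becomes `tensorδ`.
    _ = 𝟙 _ ⊗≫ B ◁ (β_ B (B ⊗ B)).hom ⊗≫ (β_ B B).hom ▷ B ▷ B ⊗≫
          B ◁ ((β_ B B).hom ≫ (β_ B B).inv) ▷ B ⊗≫
          (B ◁ MonObj.mul (X := B)) ▷ B ⊗≫ 𝟙 _ := by
      rw [Iso.hom_inv_id]
      monoidal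
    _ = _ := by monoidal

end CategoryTheory.BraidedCategory

/-! ### Products of idempotents as actions of products of points. -/

namespace CategoryTheory.BraidedCategory

variable {C : Type u₁} [Category.{v₁} C] [MonoidalCategory C] {B : C} [MonObj B]

/-- The point `1₁ ⊗ 1₂ ⊗ 1` of `(B ⊗ B) ⊗ B`. -/
def pointLeft (d : B ⟶ B ⊗ B) : 𝟙_ C ⟶ (B ⊗ B) ⊗ B :=
  (λ_ (𝟙_ C)).inv ≫ (MonObj.one ≫ d ⊗ₘ MonObj.one)

/-- The point `1 ⊗ 1₁ ⊗ 1₂` of `(B ⊗ B) ⊗ B`. -/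
def pointRight (d : B ⟶ B ⊗ B) : 𝟙_ C ⟶ (B ⊗ B) ⊗ B :=
  ((λ_ (𝟙_ C)).inv ≫ (MonObj.one ⊗ₘ MonObj.one ≫ d)) ≫ (α_ _ _ _).inv

lemma pointLeft_eq (d : B ⟶ B ⊗ B) : pointLeft d = MonObj.one ≫ d ≫ inclLeft (B ⊗ B) B := by
  rw [pointLeft, inclLeft, rightUnitor_inv_naturality_assoc, rightUnitor_inv_naturality_assoc,
    MonoidalCategory.tensorHom_def, comp_whiskerRight, unitors_inv_equal, Category.assoc]

lemma pointRight_eq (d : B ⟶ B ⊗ B) : pointRight d = MonObj.one ≫ d ≫ inclRight B B ▷ B := by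
  have h : inclRight B B ▷ B = (λ_ _).inv ≫ MonObj.one ▷ (B ⊗ B) ≫ (α_ _ _ _).inv := by
    rw [inclRight]
    monoidal
  rw [pointRight, h, leftUnitor_inv_naturality_assoc, leftUnitor_inv_naturality_assoc,
    MonoidalCategory.tensorHom_def', whiskerLeft_comp]
  simp only [Category.assoc]

variable [BraidedCategory C]

lemma pointMul_left_right (d : B ⟶ B ⊗ B) :
    pointMul (pointLeft d) (pointRight d) =
      (λ_ (𝟙_ C)).inv ≫ (MonObj.one ⊗ₘ MonObj.one) ≫ (d ⊗ₘ d) ⊗≫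
        (B ◁ MonObj.mul (X := B)) ▷ B ⊗≫ 𝟙 ((B ⊗ B) ⊗ B) := by
  rw [pointMul, pointLeft_eq, pointRight_eq, ← tensorHom_comp_tensorHom,
    ← tensorHom_comp_tensorHom, Category.assoc, Category.assoc, inclLeft_tensor_inclRight_mul]
  simp only [monoidalComp, Category.id_comp]

/-- The full braiding of `B ⊗ B` with itself disappears by naturality, since both strands carry the
same point `η ≫ d`; only the inverse crossing survives. -/
lemma pointMul_right_left (d : B ⟶ B ⊗ B) :
    pointMul (pointRight d) (pointLeft d) =
      (λ_ (𝟙_ C)).inv ≫ (MonObj.one ⊗ₘ MonObj.one) ≫ (d ⊗ₘ d) ≫ tensorδ B B B B ⊗≫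
        (B ◁ MonObj.mul (X := B)) ▷ B ⊗≫ 𝟙 ((B ⊗ B) ⊗ B) := by
  rw [pointMul, pointLeft_eq, pointRight_eq, ← tensorHom_comp_tensorHom,
    ← tensorHom_comp_tensorHom, Category.assoc, Category.assoc, inclRight_tensor_inclLeft_mul,
    braiding_naturality_assoc, braiding_naturality_assoc, leftUnitor_inv_braiding_assoc,
    unitors_inv_equal]

lemma unit_braidTau_comp (d : B ⟶ B ⊗ B) {X Y : C} (x : X ⊗ B ⟶ X) (y : Y ⊗ B ⟶ Y) :
    ((ρ_ (X ⊗ Y)).inv ≫ (X ⊗ Y) ◁ MonObj.one) ≫ braidTau d X Y ≫ (x ⊗ₘ y) =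
      pointAct (tensorAct x y) (MonObj.one ≫ d) := by
  simp only [pointAct, tensorAct, braidTau, whiskerLeft_comp, Category.assoc]

lemma unit_braidTau_braidTau_comp (d : B ⟶ B ⊗ B) {X Y Z : C} (x : X ⊗ B ⟶ X) (y : Y ⊗ B ⟶ Y)
    (z : Z ⊗ B ⟶ Z) :
    ((ρ_ ((X ⊗ Y) ⊗ Z)).inv ≫ ((X ⊗ Y) ⊗ Z) ◁ MonObj.one) ≫
        braidTau d (X ⊗ Y) Z ≫ (braidTau d X Y ≫ (x ⊗ₘ y) ⊗ₘ z) =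
      pointAct (tensorAct (tensorAct x y) z) (MonObj.one ≫ d ≫ d ▷ B) := by
  have n := tensorμ_natural_right (X ⊗ Y) Z d (𝟙 B)
  simp only [tensorHom_id, whiskerLeft_id] at n
  simp only [pointAct, whiskerLeft_comp, Category.assoc]
  rw [tensorAct, reassoc_of% n, ← tensorHom_id, tensorHom_comp_tensorHom, Category.id_comp]
  simp only [tensorAct, braidTau, Category.assoc]

lemma pointAct_whiskerRight (d : B ⟶ B ⊗ B) {X Y Z : C} (x : X ⊗ B ⟶ X) (y : Y ⊗ B ⟶ Y)
    {z : Z ⊗ B ⟶ Z} (hz : pointAct z MonObj.one = 𝟙 Z) :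
    pointAct (tensorAct x y) (MonObj.one ≫ d) ▷ Z =
      pointAct (tensorAct (tensorAct x y) z) (pointLeft d) := by
  rw [pointLeft, pointAct_tensorAct, hz, tensorHom_id]

lemma pointAct_whiskerLeft (d : B ⟶ B ⊗ B) {X Y Z : C} {x : X ⊗ B ⟶ X} (y : Y ⊗ B ⟶ Y)
    (z : Z ⊗ B ⟶ Z) (hx : pointAct x MonObj.one = 𝟙 X) :
    (α_ _ _ _).hom ≫ X ◁ pointAct (tensorAct y z) (MonObj.one ≫ d) =
      pointAct (tensorAct (tensorAct x y) z) (pointRight d) ≫ (α_ _ _ _).hom := by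
  rw [pointRight, pointAct_associator, pointAct_tensorAct, hx, id_tensorHom]

lemma pointAct_left_right (d : B ⟶ B ⊗ B) {X Y Z : C} {x : X ⊗ B ⟶ X} {y : Y ⊗ B ⟶ Y}
    {z : Z ⊗ B ⟶ Z} (hx : IsAssocAction x) (hy : IsAssocAction y) (hz : IsAssocAction z)
    (hx' : pointAct x MonObj.one = 𝟙 X) (hz' : pointAct z MonObj.one = 𝟙 Z) :
    pointAct (tensorAct x y) (MonObj.one ≫ d) ▷ Z ≫ (α_ _ _ _).hom ≫
        X ◁ pointAct (tensorAct y z) (MonObj.one ≫ d) =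
      pointAct (tensorAct (tensorAct x y) z) (pointMul (pointLeft d) (pointRight d)) ≫
        (α_ _ _ _).hom := by
  rw [pointAct_whiskerRight d x y hz', pointAct_whiskerLeft d y z hx',
    reassoc_of% ((hx.tensorAct hy).tensorAct hz).pointAct_comp]

lemma pointAct_right_left (d : B ⟶ B ⊗ B) {X Y Z : C} {x : X ⊗ B ⟶ X} {y : Y ⊗ B ⟶ Y}
    {z : Z ⊗ B ⟶ Z} (hx : IsAssocAction x) (hy : IsAssocAction y) (hz : IsAssocAction z)
    (hx' : pointAct x MonObj.one = 𝟙 X) (hz' : pointAct z MonObj.one = 𝟙 Z) :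
    (α_ _ _ _).hom ≫ X ◁ pointAct (tensorAct y z) (MonObj.one ≫ d) ≫ (α_ _ _ _).inv ≫
        pointAct (tensorAct x y) (MonObj.one ≫ d) ▷ Z =
      pointAct (tensorAct (tensorAct x y) z) (pointMul (pointRight d) (pointLeft d)) := by
  rw [pointAct_whiskerRight d x y hz', reassoc_of% pointAct_whiskerLeft d y z hx',
    Iso.hom_inv_id_assoc, ((hx.tensorAct hy).tensorAct hz).pointAct_comp]

/-- The iterated tensor action is the multiplication of the monoid `(B ⊗ B) ⊗ B`, and evaluating at
its unit recovers the point. -/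
lemma eq_of_pointAct_mul_eq {n n' : 𝟙_ C ⟶ (B ⊗ B) ⊗ B}
    (h : pointAct (tensorAct (tensorAct (MonObj.mul (X := B)) (MonObj.mul (X := B)))
        (MonObj.mul (X := B))) n =
      pointAct (tensorAct (tensorAct (MonObj.mul (X := B)) (MonObj.mul (X := B)))
        (MonObj.mul (X := B))) n') : n = n' := by
  have e := MonObj.one (X := (B ⊗ B) ⊗ B) ≫= h
  exact (one_comp_pointAct_mul n).symm.trans (e.trans (one_comp_pointAct_mul n'))

end CategoryTheory.BraidedCategory

/-! ### Translation of the compatibility conditions into the weak bimonoid axioms. -/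

namespace CategoryTheory.BraidedCategory

variable {C : Type u₁} [Category.{v₁} C] [MonoidalCategory C] {B : C} [MonObj B]

/-- The action of `B` on an algebra of the monad `• ⊗ B`. -/
def algebraAct (A : (tensorMonad B).Algebra) : A.A ⊗ B ⟶ A.A := A.a

lemma isAssocAction_algebraAct (A : (tensorMonad B).Algebra) : IsAssocAction (algebraAct A) :=
  A.assoc.symm.trans (Category.assoc _ _ _)

lemma pointAct_algebraAct_one (A : (tensorMonad B).Algebra) :
    pointAct (algebraAct A) MonObj.one = 𝟙 A.A :=
  (Category.assoc _ _ _).symm.trans A.unit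

variable (B) in
/-- The regular algebra of the monad `• ⊗ B`. -/
def regularAlgebra : (tensorMonad B).Algebra where
  A := B
  a := (MonObj.mul : B ⊗ B ⟶ B)
  unit := (Category.assoc _ _ _).trans <| by
    have h : (ρ_ B).inv ≫ B ◁ MonObj.one ≫ MonObj.mul = 𝟙 B := by
      rw [MonObj.mul_one, Iso.inv_hom_id]
    exact h
  assoc := (Category.assoc _ _ _).trans (MonObj.mul_assoc B).symm

section

variable [BraidedCategory C] (b : ComonObj B)

lemma form_oplaxOfComon :
    letI := oplaxOfComon b
    (tensorMonad B).form = (λ_ B).hom ▷ B ≫ MonObj.mul ≫ b.counit := by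
  have : ((α_ (𝟙_ C) B B).hom ≫ 𝟙_ C ◁ MonObj.mul) ≫ (λ_ B).hom ≫ b.counit =
      (λ_ B).hom ▷ B ≫ MonObj.mul ≫ b.counit := by
    rw [Category.assoc, leftUnitor_naturality_assoc]
    monoidal
  exact this

lemma contractL₀_oplaxOfComon :
    letI := oplaxOfComon b
    (tensorMonad B).contractL₀ =
      (λ_ B).hom ▷ B ≫ contractLeft b.comul (MonObj.mul ≫ b.counit) ≫ (λ_ B).inv := by
  let := oplaxOfComon b
  rw [← contractLeft_eq, ← form_oplaxOfComon]
  rfl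

lemma contractR₀_oplaxOfComon :
    letI := oplaxOfComon b
    (tensorMonad B).contractR₀ =
      (λ_ B).hom ▷ B ≫ contractRight b.comul (MonObj.mul ≫ b.counit) ≫ (λ_ B).inv := by
  let := oplaxOfComon b
  rw [← contractRight_eq, ← form_oplaxOfComon]
  rfl

lemma form_comp_iff (c : B ⊗ B ⟶ B) :
    letI := oplaxOfComon b
    ((tensorMonad B).map ((λ_ B).hom ▷ B ≫ c ≫ (λ_ B).inv) ≫ (tensorMonad B).form =
        (tensorMonad B).mul _ ≫ (tensorMonad B).form) ↔
      c ▷ B ≫ MonObj.mul ≫ b.counit = MonObj.mul ▷ B ≫ MonObj.mul ≫ b.counit := by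
  let := oplaxOfComon b
  rw [form_oplaxOfComon]
  have h₁ : ((λ_ B).hom ▷ B ≫ c ≫ (λ_ B).inv) ▷ B ≫ (λ_ B).hom ▷ B ≫ MonObj.mul ≫ b.counit =
      (λ_ B).hom ▷ B ▷ B ≫ c ▷ B ≫ MonObj.mul ≫ b.counit := by
    rw [← comp_whiskerRight_assoc]
    simp
  have h₂ : ((α_ (𝟙_ C ⊗ B) B B).hom ≫ (𝟙_ C ⊗ B) ◁ MonObj.mul) ≫
        (λ_ B).hom ▷ B ≫ MonObj.mul ≫ b.counit =
      (λ_ B).hom ▷ B ▷ B ≫ MonObj.mul ▷ B ≫ MonObj.mul ≫ b.counit := by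
    rw [MonObj.mul_assoc_assoc, Category.assoc, whisker_exchange_assoc,
      associator_naturality_left_assoc]
  have h₃ : ((λ_ B).hom ▷ B ≫ c ≫ (λ_ B).inv) ▷ B ≫ (λ_ B).hom ▷ B ≫ MonObj.mul ≫ b.counit =
      ((α_ (𝟙_ C ⊗ B) B B).hom ≫ (𝟙_ C ⊗ B) ◁ MonObj.mul) ≫
        (λ_ B).hom ▷ B ≫ MonObj.mul ≫ b.counit ↔
      c ▷ B ≫ MonObj.mul ≫ b.counit = MonObj.mul ▷ B ≫ MonObj.mul ≫ b.counit := by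
    rw [h₁, h₂, cancel_epi]
  exact h₃

lemma form_contractL_oplaxOfComon_iff :
    letI := oplaxOfComon b
    ((tensorMonad B).map (tensorMonad B).contractL₀ ≫ (tensorMonad B).form =
        (tensorMonad B).mul _ ≫ (tensorMonad B).form) ↔
      MonObj.mul ▷ B ≫ MonObj.mul ≫ b.counit = (B ◁ b.comul) ▷ B ⊗≫
        (MonObj.mul ⊗ₘ MonObj.mul) ≫ (b.counit ⊗ₘ b.counit) ≫ (λ_ (𝟙_ C)).hom := by
  let := oplaxOfComon b
  rw [contractL₀_oplaxOfComon]
  exact (form_comp_iff b _).trans (by rw [contractLeft_comp, eq_comm])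

lemma form_contractR_oplaxOfComon_iff :
    letI := oplaxOfComon b
    ((tensorMonad B).map (tensorMonad B).contractR₀ ≫ (tensorMonad B).form =
        (tensorMonad B).mul _ ≫ (tensorMonad B).form) ↔
      MonObj.mul ▷ B ≫ MonObj.mul ≫ b.counit = (B ◁ b.comul) ▷ B ⊗≫ tensorδ B B B B ≫
        (MonObj.mul ⊗ₘ MonObj.mul) ≫ (b.counit ⊗ₘ b.counit) ≫ (λ_ (𝟙_ C)).hom := by
  let := oplaxOfComon b
  rw [contractR₀_oplaxOfComon]
  exact (form_comp_iff b _).trans (by rw [contractRight_comp, eq_comm])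

lemma idem_oplaxOfComon (A A' : (tensorMonad B).Algebra) :
    letI := oplaxOfComon b
    Monad.idem A A' =
      pointAct (tensorAct (algebraAct A) (algebraAct A')) (MonObj.one ≫ b.comul) :=
  unit_braidTau_comp b.comul (algebraAct A) (algebraAct A')

lemma unit_actL_oplaxOfComon (A A' A'' : (tensorMonad B).Algebra) :
    letI := oplaxOfComon b
    (tensorMonad B).unit _ ≫ Monad.actL A A' A'' =
      pointAct (tensorAct (tensorAct (algebraAct A) (algebraAct A')) (algebraAct A''))
        (MonObj.one ≫ b.comul ≫ b.comul ▷ B) :=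
  unit_braidTau_braidTau_comp b.comul (algebraAct A) (algebraAct A') (algebraAct A'')

end

variable [BraidedCategory C]

lemma isWeaklyBimonoidal_oplaxOfComon (b : WeakBimonoid B) :
    letI := oplaxOfComon b.toComonObj
    (tensorMonad B).IsWeaklyBimonoidal := by
  let := oplaxOfComon b.toComonObj
  refine ⟨mul_braidTau b.comul MonObj.mul b.mul_comul,
    (form_contractL_oplaxOfComon_iff _).2 b.counit_mul_mul,
    (form_contractR_oplaxOfComon_iff _).2 b.counit_mul_mul_braid,
    fun A A' A'' ↦ ?_, fun A A' A'' ↦ ?_⟩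
  · have := pointAct_left_right b.comul (isAssocAction_algebraAct A) (isAssocAction_algebraAct A')
      (isAssocAction_algebraAct A'') (pointAct_algebraAct_one A) (pointAct_algebraAct_one A'')
    rw [idem_oplaxOfComon, idem_oplaxOfComon, this, pointMul_left_right, ← b.comul_comul_one,
      ← unit_actL_oplaxOfComon, Category.assoc]
  · have := pointAct_right_left b.comul (isAssocAction_algebraAct A) (isAssocAction_algebraAct A')
      (isAssocAction_algebraAct A'') (pointAct_algebraAct_one A) (pointAct_algebraAct_one A'')
    rw [← cancel_epi (α_ A.A A'.A A''.A).hom, idem_oplaxOfComon, idem_oplaxOfComon, this,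
      pointMul_right_left, ← b.comul_comul_one_braid, ← unit_actL_oplaxOfComon,
      reassoc_of% Monad.comp_unit, ← reassoc_of% Monad.actL_associator, Iso.hom_inv_id,
      Category.comp_id]

/-- The weak bimonoid given by a comonoid for which the opmonoidal structure on `• ⊗ B`
is weakly bimonoidal. -/
@[reducible]
def weakBimonoidOfComon (b : ComonObj B)
    (h : letI := oplaxOfComon b; (tensorMonad B).IsWeaklyBimonoidal) : WeakBimonoid B where
  toComonObj := b
  mul_comul := mul_comul_of_braidTau _ _ <|
    letI := oplaxOfComon b
    h.mul_δ (𝟙_ C) (𝟙_ C)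
  counit_mul_mul := (form_contractL_oplaxOfComon_iff b).1 <|
    letI := oplaxOfComon b
    h.form_contractL
  counit_mul_mul_braid := (form_contractR_oplaxOfComon_iff b).1 <|
    letI := oplaxOfComon b
    h.form_contractR
  comul_comul_one := by
    let := oplaxOfComon b
    -- The condition holds for all algebras, but three copies of the regular one suffice, since
    -- points of `(B ⊗ B) ⊗ B` act faithfully on them.
    let R := regularAlgebra B
    have e := h.idem_left_right R R R
    rw [idem_oplaxOfComon, pointAct_left_right b.comul (isAssocAction_algebraAct R)
      (isAssocAction_algebraAct R) (isAssocAction_algebraAct R) (pointAct_algebraAct_one R)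
      (pointAct_algebraAct_one R), reassoc_of% unit_actL_oplaxOfComon, cancel_mono] at e
    rw [← pointMul_left_right]
    exact (eq_of_pointAct_mul_eq (B := B) e).symm
  comul_comul_one_braid := by
    let := oplaxOfComon b
    let R := regularAlgebra B
    have e := (α_ R.A R.A R.A).hom ≫= h.idem_right_left R R R
    rw [idem_oplaxOfComon, pointAct_right_left b.comul (isAssocAction_algebraAct R)
      (isAssocAction_algebraAct R) (isAssocAction_algebraAct R) (pointAct_algebraAct_one R)
      (pointAct_algebraAct_one R), reassoc_of% Monad.comp_unit,
      ← reassoc_of% Monad.actL_associator, Iso.hom_inv_id, Category.comp_id,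
      unit_actL_oplaxOfComon] at e
    rw [← pointMul_right_left]
    exact (eq_of_pointAct_mul_eq (B := B) e).symm

end CategoryTheory.BraidedCategory

/-! ### Assembling the bijection. -/

lemma WeakBimonoid.ext_toComonObj {C : Type u₁} [Category.{v₁} C] [MonoidalCategory C]
    [BraidedCategory C] {B : C} [MonObj B] {b b' : WeakBimonoid B}
    (h : b.toComonObj = b'.toComonObj) : b = b' := by
  cases b
  cases b'
  cases h
  rfl

lemma CategoryTheory.ComonObj.ext_comul_counit {C : Type u₁} [Category.{v₁} C] [MonoidalCategory C]
    {B : C} {b b' : ComonObj B} (h : b.comul = b'.comul) (h' : b.counit = b'.counit) : b = b' := by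
  cases b
  cases b'
  cases h
  cases h'
  rfl

open BraidedCategory in
/-- Weak bimonoid structures correspond to opmonoidal structures that underlie a weak bimonad and
factor through the braiding. -/
def weakBimonoidEquiv {C : Type u₁} [Category.{v₁} C] [MonoidalCategory C] [BraidedCategory C]
    [IsIdempotentComplete C] (B : C) [MonObj B] : WeakBimonoid B ≃ BraidedWeakBimonad B where
  toFun b := ⟨oplaxOfComon b.toComonObj,
    letI := oplaxOfComon b.toComonObj
    (isWeaklyBimonoidal_oplaxOfComon b).exists_weakBimonad,
    factorsThroughBraiding_oplaxOfComon b.toComonObj⟩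
  invFun t := weakBimonoidOfComon (comonOfOplax t.1 t.2.2) <| by
    obtain ⟨W, hW⟩ := t.2.1
    -- The opmonoidal structure rebuilt from the extracted comonoid is `t.1` itself, so the
    -- conditions coming from `W` apply to it.
    rw [oplaxOfComon_comonOfOplax]
    let := t.1
    exact W.isWeaklyBimonoidal hW
  left_inv b := WeakBimonoid.ext_toComonObj <| ComonObj.ext_comul_counit
    (comulOf_oplaxOfComon b.toComonObj) (counitOf_oplaxOfComon b.toComonObj)
  right_inv t := Subtype.ext (oplaxOfComon_comonOfOplax t.1 t.2.2)

theorem theorem3p1 {C : Type u₁} [Category.{v₁} C] [MonoidalCategory C] [BraidedCategory C]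
    [IsIdempotentComplete C] (B : C) [MonObj B] :
    (∃ e : WeakBimonoid B ≃ BraidedWeakBimonad B,
      (∀ b : WeakBimonoid B,
        (∀ X Y : C, (e b).1.δ X Y = (X ⊗ Y) ◁ b.comul ≫ tensorμ X Y B B) ∧
          (e b).1.η = (λ_ B).hom ≫ b.counit) ∧
      (∀ t : BraidedWeakBimonad B,
        (e.symm t).comul = comulOf B t.1 ∧ (e.symm t).counit = counitOf B t.1)) ∧
    (∀ W W' : WeakBimonad (tensorMonad B),
      W.opmonoidal = W'.opmonoidal ↔ Nonempty (W.Iso W')) :=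
  ⟨⟨weakBimonoidEquiv B, fun _ ↦ ⟨fun _ _ ↦ rfl, rfl⟩, fun _ ↦ ⟨rfl, rfl⟩⟩,
    WeakBimonad.opmonoidal_eq_iff⟩
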